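/- Proposition 11.2. Let $\omega\in\mathbb C$ with $\operatorname{Im}\omega>0$, put $q=e^{i\pi\omega}$ and $\Lambda=\pi\mathbb Z+\pi\omega\mathbb Z$, and let $J=\begin{pmatrix}0&-1\\1&0\end{pmatrix}$. On $\ell^2(\mathbb Z;\mathbb C^2)$ consider the bounded block-diagonal operators $$A=C=\operatorname{diag}[J]_{n\in\mathbb Z},\qquad E=\operatorname{diag}[q^{2|n|}I_2]_{n\in\mathbb Z},\qquad B=2E .$$ Let $\varphi(x)=Ce^{-xA}B$, $T(x)=e^{-xA}Ee^{-xA}$ and, where $I-T(x)$ is invertible, $W(x,y)=Ce^{-xA}(I-T(x))^{-1}e^{-yA}B$. Then $(-A,B,C;E)$ is a periodic linear system with sign $+1$, that is, $BC=AE+EA$, $BE=EB$, $EA=AE$ and $e^{2\pi A}=I$, and the following hold. (i) For all real $0<x<y<2\pi$ with $x\neq\pi$, the operator $I-T(x)$ is invertible and the Gelfand–Levitan equation $$-\varphi(x+y)+W(x,y)-\int_x^{2\pi}W(x,z)\varphi(z+y)\,dz=W(x,y)E$$ holds, with a norm-integrable integrand. For all $x\in\mathbb C$ the operator $\varphi(x)$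 is of trace class and $$\operatorname{trace}\varphi(x)=4\,\frac{1+q^2}{1-q^2}\,\sin x .$$ (ii) For all $x\in\mathbb C$ the operator $T(x)$ is of trace class; let $\tau(x)=\det(I-T(x))$ be its Fredholm determinant (the limit of the determinants of the finite sections). For $x\notin\Lambda$ the operator $I-T(x)$ is invertible, $\tau(x)\ne0$, $W(x,x)$ is of trace class, and $\tau'(x)/\tau(x)=\operatorname{trace}W(x,x)$; in particular $\tau(x)=\tau(a)\exp\bigl(\int_a^x\operatorname{trace}W(y,y)\,dy\bigr)$ for $a,x\in(0,\pi)$. With $\theta_1(x)=2\sum_{n\ge0}(-1)^nq^{(n+1/2)^2}\sin((2n+1)x)$, where $q^s=e^{i\pi\omega s}$, $$\tau(x)=\frac{\theta_1(x)^2}{q^{1/2}\prod_{n=1}^\infty(1-q^{2n})^2}\qquad(x\in\mathbb C).$$ The function $\tau$ is entire and belongs to a Liouvillian extension of the field of elliptic functions (the $\Lambda$-periodic meromorphic functions on $\mathbb C$), that is, to a differential field of meromorphic functions on $\mathbb C$ obtained from it by successively adjoining finitely many functions, each of them an integral of, an exponential of an integral of, or algebraic over, the preceding field. Finally, with $\wp$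 the Weierstrass function of the lattice $\Lambda$, for all $x\in\mathbb C\setminus\Lambda$, $$2\wp(x)=-\frac{d^2}{dx^2}\log\tau(x)+2\wp\!\left(\tfrac{\pi}{2}\right)+\frac{d^2}{dx^2}\log\tau(x)\Big|_{x=\pi/2}.$$ -/

import Mathlib

open scoped Real Topology UpperHalfPlane PeriodPair
open Filter

noncomputable section

namespace PeriodicSystem

/-! ### Operators on the Hilbert space of square summable families -/

/-- The Hilbert space `ℓ²(ι)`. -/
abbrev Ell2 (ι : Type) : Type := lp (fun _ : ι => ℂ) 2

/-- Bounded operators on `ℓ²(ι)`. -/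
abbrev Op (ι : Type) : Type := Ell2 ι →L[ℂ] Ell2 ι

section General

variable {ι : Type} [DecidableEq ι]

/-- The entry in row `i` and column `j` of the infinite matrix of a bounded operator on `ℓ²(ι)`. -/
def entry (T : Op ι) (i j : ι) : ℂ := (T (lp.single 2 j (1 : ℂ)) : ι → ℂ) i

/-- Trace class operators on a Hilbert space: `T = ∑ₙ ⟨aₙ, ·⟩ bₙ` with `∑ₙ ‖aₙ‖ ‖bₙ‖ < ∞`. -/
def IsTraceClass (T : Op ι) : Prop :=
  ∃ a b : ℕ → Ell2 ι, (Summable fun n => ‖a n‖ * ‖b n‖) ∧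
    ∀ v : Ell2 ι, HasSum (fun n => (inner ℂ (a n) v) • b n) (T v)

/-- The trace, as the sum of the diagonal entries. -/
def trace (T : Op ι) : ℂ := ∑' i, entry T i i

/-- `T` is trace class and its trace, the sum of the diagonal entries, is `t`. -/
def HasTrace (T : Op ι) (t : ℂ) : Prop :=
  IsTraceClass T ∧ HasSum (fun i => entry T i i) t

/-- The determinant of the finite section of `I - T` with rows and columns in `F`. -/
def sectionDet (T : Op ι) (F : Finset ι) : ℂ :=
  (1 - Matrix.of fun i j : {k // k ∈ F} => entry T i j).det

/-- The Fredholm determinant `det (I - T)` of a trace class operator `T` on `ℓ²(ι)`, as the limit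
of the determinants of the finite sections. -/
def fredholmDet (T : Op ι) : ℂ := limUnder atTop (sectionDet T)

/-- `T` is trace class and the Fredholm determinant `det (I - T)` exists and equals `d`. -/
def HasFredholmDet (T : Op ι) (d : ℂ) : Prop :=
  IsTraceClass T ∧ Tendsto (sectionDet T) atTop (𝓝 d)

end General

section LinearSystem

variable {ι : Type}

/-- The group `e^{-xA}`. -/
def expNeg (A : Op ι) (x : ℂ) : Op ι := NormedSpace.exp (-(x • A))

/-- Periodic linear systems `(-A, B, C; E)` with sign `ε`. -/
structure IsPeriodicLinearSystem (A B C E : Op ι) (ε : ℤ) : Prop where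
  sign : ε = 1 ∨ ε = -1
  BC_eq : B * C = ε • (A * E + E * A)
  BE_comm : B * E = E * B
  EA_comm : E * A = A * E
  periodic : NormedSpace.exp ((2 * (π : ℂ)) • A) = 1

/-- The scattering function `φ(x) = C e^{-xA} B`. -/
def scattering (A B C : Op ι) (x : ℂ) : Op ι := C * expNeg A x * B

/-- The kernel `W(x,y) = C e^{-xA} (I - e^{-xA} E e^{-xA})⁻¹ e^{-yA} B`; it is meaningful where
`I - e^{-xA} E e^{-xA}` is invertible. -/
def kernelW (A B C E : Op ι) (x y : ℂ) : Op ι :=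
  C * expNeg A x * Ring.inverse (1 - expNeg A x * E * expNeg A x) * expNeg A y * B

/-- The tau function `τ(x) = det (I - e^{-xA} E e^{-xA})`. -/
def tau [DecidableEq ι] (A E : Op ι) (x : ℂ) : ℂ :=
  fredholmDet (expNeg A x * E * expNeg A x)

end LinearSystem

/-! ### Block diagonal operators with `2 × 2` blocks -/

/-- The index set of block vectors: the index `(n, a)` is the `a`-th coordinate of the `n`-th
block, so that `ℓ²(Idx)` is `ℓ²(ℤ; ℂ²)`. -/
abbrev Idx : Type := ℤ × Fin 2

/-- A bounded family of `2 × 2` matrices applied blockwise to a family of vectors. -/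
def blockMul (M : ℤ → Matrix (Fin 2) (Fin 2) ℂ) (v : Idx → ℂ) : Idx → ℂ :=
  fun p => ∑ b, M p.1 p.2 b * v (p.1, b)

lemma sq_norm_blockMul_le {M : ℤ → Matrix (Fin 2) (Fin 2) ℂ} {c : ℝ}
    (hM : ∀ n a b, ‖M n a b‖ ≤ c) (v : Idx → ℂ) (p : Idx) :
    ‖blockMul M v p‖ ^ 2 ≤ 2 * c ^ 2 * (‖v (p.1, 0)‖ ^ 2 + ‖v (p.1, 1)‖ ^ 2) := by
  have h : ‖blockMul M v p‖ ≤ c * ‖v (p.1, 0)‖ + c * ‖v (p.1, 1)‖ := by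
    simp only [blockMul, Fin.sum_univ_two]
    refine (norm_add_le _ _).trans ?_
    rw [norm_mul, norm_mul]
    gcongr <;> exact hM _ _ _
  have h2 : ‖blockMul M v p‖ ^ 2 ≤ (c * ‖v (p.1, 0)‖ + c * ‖v (p.1, 1)‖) ^ 2 := by gcongr
  nlinarith [sq_nonneg (c * ‖v (p.1, 0)‖ - c * ‖v (p.1, 1)‖)]

lemma hasSum_bound (v : Ell2 Idx) (c : ℝ) :
    HasSum (fun p : Idx => 2 * c ^ 2 * (‖v (p.1, 0)‖ ^ 2 + ‖v (p.1, 1)‖ ^ 2))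
      (4 * c ^ 2 * ‖v‖ ^ 2) := by
  have hv : HasSum (fun p : Idx => ‖v p‖ ^ 2) (‖v‖ ^ 2) := by
    have := lp.hasSum_norm (p := 2) (by norm_num) v
    simpa using this
  have hc : HasSum (fun n : ℤ => ‖v (n, 0)‖ ^ 2 + ‖v (n, 1)‖ ^ 2) (‖v‖ ^ 2) := by
    have := hv.prod_fiberwise (g := fun n : ℤ => ‖v (n, 0)‖ ^ 2 + ‖v (n, 1)‖ ^ 2) (fun n => by
      have := hasSum_fintype (fun b : Fin 2 => ‖v (n, b)‖ ^ 2)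
      simpa [Fin.sum_univ_two] using this)
    exact this
  have hs : HasSum (fun p : Fin 2 × ℤ => ‖v (p.2, 0)‖ ^ 2 + ‖v (p.2, 1)‖ ^ 2)
      (2 * ‖v‖ ^ 2) := by
    have h0 : Summable (fun p : Fin 2 × ℤ => ‖v (p.2, 0)‖ ^ 2 + ‖v (p.2, 1)‖ ^ 2) := by
      rw [summable_prod_of_nonneg (fun p => by positivity)]
      exact ⟨fun _ => hc.summable, (hasSum_fintype _).summable⟩
    have h1 := h0.hasSum.prod_fiberwise (fun _ => hc)
    have h2 := hasSum_fintype (fun _ : Fin 2 => ‖v‖ ^ 2)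
    have h3 := h1.unique h2
    rw [Fin.sum_univ_two] at h3
    rw [two_mul, ← h3]
    exact h0.hasSum
  have hs' := (Equiv.prodComm ℤ (Fin 2)).hasSum_iff.2 hs
  have h4 := hs'.mul_left (2 * c ^ 2)
  rw [show 4 * c ^ 2 * ‖v‖ ^ 2 = 2 * c ^ 2 * (2 * ‖v‖ ^ 2) by ring]
  exact h4

lemma memℓp_blockMul {M : ℤ → Matrix (Fin 2) (Fin 2) ℂ} {c : ℝ}
    (hM : ∀ n a b, ‖M n a b‖ ≤ c) (v : Ell2 Idx) : Memℓp (blockMul M v) 2 := by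
  refine memℓp_gen ?_
  have h : Summable fun p : Idx => ‖blockMul M v p‖ ^ 2 :=
    Summable.of_nonneg_of_le (fun p => by positivity) (sq_norm_blockMul_le hM v)
      (hasSum_bound v c).summable
  simpa using h

/-- The block diagonal operator `diagonal[M n]` on `ℓ²(ℤ; ℂ²)`, where the entries of the
`2 × 2` blocks `M n` are bounded by `c`. -/
def blockDiag (M : ℤ → Matrix (Fin 2) (Fin 2) ℂ) (c : ℝ) (hM : ∀ n a b, ‖M n a b‖ ≤ c) :
    Op Idx :=
  LinearMap.mkContinuous
    { toFun := fun v => ⟨blockMul M v, memℓp_blockMul hM v⟩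
      map_add' := fun v w => by
        ext p
        simp only [blockMul, Fin.sum_univ_two, lp.coeFn_add, Pi.add_apply]
        ring
      map_smul' := fun r v => by
        ext p
        simp only [blockMul, Fin.sum_univ_two, lp.coeFn_smul, Pi.smul_apply, smul_eq_mul,
          RingHom.id_apply]
        ring }
    (2 * |c|)
    (fun v => by
      have h2 : HasSum (fun p : Idx => ‖blockMul M v p‖ ^ 2)
          (‖(⟨blockMul M v, memℓp_blockMul hM v⟩ : Ell2 Idx)‖ ^ 2) := by
        have := lp.hasSum_norm (p := 2) (by norm_num)
          (⟨blockMul M v, memℓp_blockMul hM v⟩ : Ell2 Idx)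
        simpa using this
      have h3 := hasSum_le (sq_norm_blockMul_le hM v) h2 (hasSum_bound v c)
      refine le_of_sq_le_sq ?_ (by positivity)
      calc _ ≤ 4 * c ^ 2 * ‖v‖ ^ 2 := h3
        _ = (2 * |c| * ‖v‖) ^ 2 := by rw [mul_pow, mul_pow, sq_abs]; ring)

lemma blockDiag_apply (M : ℤ → Matrix (Fin 2) (Fin 2) ℂ) (c : ℝ)
    (hM : ∀ n a b, ‖M n a b‖ ≤ c) (v : Ell2 Idx) (p : Idx) :
    (blockDiag M c hM v : Idx → ℂ) p = ∑ b, M p.1 p.2 b * v (p.1, b) := rfl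

/-! ### The system attached to a point `ω` of the upper half-plane -/

/-- `q = e^{iπω}`. -/
def nome (ω : ℍ) : ℂ := Complex.exp (π * Complex.I * ω)

lemma norm_nome_lt_one (ω : ℍ) : ‖nome ω‖ < 1 := by
  have h : 0 < π * ω.im := mul_pos Real.pi_pos ω.im_pos
  rw [nome, Complex.norm_exp, Real.exp_lt_one_iff]
  simpa using h

/-- The rotation matrix `J`. -/
def J : Matrix (Fin 2) (Fin 2) ℂ := !![0, -1; 1, 0]

/-- `A = diagonal[J]`. -/
def opA : Op Idx := blockDiag (fun _ => J) 1 (fun _ a b => by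
  fin_cases a <;> fin_cases b <;> simp [J])

/-- `C = A`. -/
def opC : Op Idx := opA

/-- `E = diagonal[q^{2|n|} I₂]`. -/
def opE (ω : ℍ) : Op Idx :=
  blockDiag (fun n => (nome ω ^ (2 * n.natAbs)) • (1 : Matrix (Fin 2) (Fin 2) ℂ)) 1
    (fun n a b => by
      have h : ‖nome ω‖ ^ (2 * n.natAbs) ≤ 1 :=
        pow_le_one₀ (norm_nonneg _) (norm_nome_lt_one ω).le
      fin_cases a <;> fin_cases b <;> simp [h])

/-- `B = 2E`. -/
def opB (ω : ℍ) : Op Idx := (2 : ℂ) • opE ω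

/-- The operator `e^{-xA} E e^{-xA}` of the system attached to `ω`. -/
def opT (ω : ℍ) (x : ℂ) : Op Idx := expNeg opA x * opE ω * expNeg opA x

/-- `φ(x) = C e^{-xA} B` for the system attached to `ω`. -/
def phi (ω : ℍ) (x : ℂ) : Op Idx := scattering opA (opB ω) opC x

/-- `W(x,y)` for the system attached to `ω`. -/
def W (ω : ℍ) (x y : ℂ) : Op Idx := kernelW opA (opB ω) opC (opE ω) x y

/-- The tau function of the system attached to `ω`. -/
def tauFun (ω : ℍ) (x : ℂ) : ℂ := tau opA (opE ω) x

/-- `d²/dx² log τ(x)`, as the derivative of the logarithmic derivative `τ'/τ`, so that no branch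
of the logarithm has to be chosen. -/
def d2LogTau (ω : ℍ) (x : ℂ) : ℂ := deriv (logDeriv (tauFun ω)) x

/-! ### Theta function and period lattice -/

/-- Jacobi's theta function
`θ₁(x) = 2 ∑_{n ≥ 0} (-1)ⁿ q^{(n+1/2)²} sin((2n+1)x)` with `q = e^{iπω}`. -/
def theta1 (ω : ℍ) (x : ℂ) : ℂ :=
  2 * ∑' n : ℕ, (-1) ^ n * Complex.exp (π * Complex.I * ω * ((n : ℂ) + 1 / 2) ^ 2) *
    Complex.sin ((2 * n + 1) * x)

/-- The pair of periods `π`, `πω`. -/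
def periods (ω : ℍ) : PeriodPair where
  ω₁ := π
  ω₂ := π * ω
  indep := by
    rw [LinearIndependent.pair_iff]
    intro s t h
    have hpi := Real.pi_pos.ne'
    have him := congrArg Complex.im h
    have hre := congrArg Complex.re h
    have ht : t = 0 := by
      have : t * (π * ω.im) = 0 := by simpa using him
      exact (mul_eq_zero.1 this).resolve_right (mul_pos Real.pi_pos ω.im_pos).ne'
    subst ht
    refine ⟨?_, rfl⟩
    have : s * π = 0 := by simpa using hre
    exact (mul_eq_zero.1 this).resolve_right hpi

/-! ### Differential fields of meromorphic functions and Liouvillian extensions -/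

/-- `K` is a differential field of meromorphic functions on `ℂ` that contains the constants.
Meromorphic functions are represented by functions `ℂ → ℂ`, and two of them are identified when
they agree off a discrete closed set; `K` is the set of all representatives. -/
structure IsDifferentialField (K : Set (ℂ → ℂ)) : Prop where
  meromorphic : ∀ f ∈ K, Meromorphic f
  congr : ∀ f ∈ K, ∀ g : ℂ → ℂ, g =ᶠ[codiscrete ℂ] f → g ∈ K
  const_mem : ∀ c : ℂ, (fun _ => c) ∈ K
  add_mem : ∀ f ∈ K, ∀ g ∈ K, f + g ∈ K
  mul_mem : ∀ f ∈ K, ∀ g ∈ K, f * g ∈ K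
  inv_mem : ∀ f ∈ K, f⁻¹ ∈ K
  deriv_mem : ∀ f ∈ K, deriv f ∈ K

/-- The differential field generated by `K` and `h`. -/
def adjoin (K : Set (ℂ → ℂ)) (h : ℂ → ℂ) : Set (ℂ → ℂ) :=
  ⋂₀ {L | IsDifferentialField L ∧ K ⊆ L ∧ h ∈ L}

/-- `h` is algebraic over `K`: it is a root of a nonzero polynomial with coefficients in `K`. -/
def IsAlgebraicOver (K : Set (ℂ → ℂ)) (h : ℂ → ℂ) : Prop :=
  ∃ (n : ℕ) (a : Fin (n + 1) → ℂ → ℂ), (∀ i, a i ∈ K) ∧ (∃ i, ¬ a i =ᶠ[codiscrete ℂ] 0) ∧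
    (fun z => ∑ i, a i z * h z ^ (i : ℕ)) =ᶠ[codiscrete ℂ] 0

/-- The meromorphic function `h` is an integral of an element of `K`, an exponential of an
integral of an element of `K`, or algebraic over `K`. -/
def IsLiouvilleGenerator (K : Set (ℂ → ℂ)) (h : ℂ → ℂ) : Prop :=
  Meromorphic h ∧
    ((∃ g ∈ K, deriv h =ᶠ[codiscrete ℂ] g) ∨
      (¬ h =ᶠ[codiscrete ℂ] 0 ∧ ∃ g ∈ K, deriv h =ᶠ[codiscrete ℂ] g * h) ∨
      IsAlgebraicOver K h)

/-- `IsLiouvillianExtension K L`: the differential field `L` arises from the differential field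
`K` by finitely many adjunctions of integrals, exponentials of integrals, or algebraic
functions. -/
inductive IsLiouvillianExtension (K : Set (ℂ → ℂ)) : Set (ℂ → ℂ) → Prop
  | refl : IsDifferentialField K → IsLiouvillianExtension K K
  | step {L : Set (ℂ → ℂ)} {h : ℂ → ℂ} : IsLiouvillianExtension K L →
      IsLiouvilleGenerator L h → IsLiouvillianExtension K (adjoin L h)

/-- The elliptic function field of a lattice: the meromorphic functions on `ℂ` that are periodic
with respect to the lattice. -/
def ellipticField (L : PeriodPair) : Set (ℂ → ℂ) :=
  {f | Meromorphic f ∧ ∀ l ∈ L.lattice, (fun z => f (z + l)) =ᶠ[codiscrete ℂ] f}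

end PeriodicSystem

end

noncomputable section

namespace PeriodicSystem

/-! ### Exponentials of square roots of `-1` -/

/-! All operators are block diagonal and, since `A * A = -1`, lie in the commutative algebra
generated by `A` and the operators that are scalar on each block. Euler's formula gives e^{-xA} =
cos x - (sin x) A, so T(x) = e^{-2xA} E, and the n-th block of I - T(x) has determinant D_n = (1 - c
e^{2ix})(1 - c e^{-2ix}) with c = q^{2|n|}. This vanishes only on Λ and tends to 1 as |n| grows, so
off Λ the adjugate divided by the determinant is a bounded inverse R (`one_sub_opT_mul_resolvent`).
The Gelfand–Levitan integrand is a multiple of e^{-(x+y+2z)A} with an explicit primitive;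
periodicity and T R = R - 1 evaluate its endpoints (`gelfand_levitan`).

The finite sections converge to τ = ∏ D_n (`tendsto_sectionDet_opT`), and the trace of W(x,x) is ∑
D_n'/D_n, the logarithmic derivative of that product. As D_n = D_{-n}, τ is D_0 times the square of
the product over n ≥ 1, and Jacobi's triple product, proved from its finite form, turns this into
θ₁² (`tauFun_eq_theta1`).

The period π leaves τ unchanged and πω multiplies it by the exponential of an affine function, so
(log τ)'' is elliptic. Hence τ'/τ is an integral of an elliptic function, and τ is an exponential of
an integral of τ'/τ. Finally τ has a double zero at 0, so the poles of 2℘ + (log τ)'' cancel; an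
entire elliptic function is constant (`two_mul_weierstrassP_add_d2LogTau`). -/

lemma exp_smul_of_mul_self_eq_neg_one {𝔸 : Type*} [NormedRing 𝔸] [NormedAlgebra ℂ 𝔸]
    [CompleteSpace 𝔸] {a : 𝔸} (ha : a * a = -1) (x : ℂ) :
    NormedSpace.exp (x • a) = Complex.cos x • (1 : 𝔸) + Complex.sin x • a := by
  -- Multiplying by the conjugate cos t - (sin t) a, which is the expected inverse, gives a function
  -- with zero derivative and value 1 at 0.
  have hd (t : ℂ) : HasDerivAt (fun t : ℂ => NormedSpace.exp (t • a) *
      (Complex.cos t • (1 : 𝔸) - Complex.sin t • a)) 0 t := by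
    have h1 := hasDerivAt_exp_smul_const (𝕂 := ℂ) a t
    have h2 := ((Complex.hasDerivAt_cos t).smul_const (1 : 𝔸)).sub
      ((Complex.hasDerivAt_sin t).smul_const a)
    refine (h1.mul h2).congr_deriv ?_
    change NormedSpace.exp (t • a) * a * (Complex.cos t • (1 : 𝔸) - Complex.sin t • a) +
      NormedSpace.exp (t • a) * (-Complex.sin t • (1 : 𝔸) - Complex.cos t • a) = 0
    rw [mul_assoc, ← mul_add]
    convert mul_zero _ using 2
    simp only [mul_sub, mul_smul_comm, mul_one, ha]
    module
  have hc : NormedSpace.exp (x • a) * (Complex.cos x • (1 : 𝔸) - Complex.sin x • a) = 1 := by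
    have := is_const_of_deriv_eq_zero (fun t => (hd t).differentiableAt) (fun t => (hd t).deriv) x 0
    simpa using this
  have hr : (Complex.cos x • (1 : 𝔸) - Complex.sin x • a) *
      (Complex.cos x • (1 : 𝔸) + Complex.sin x • a) = 1 := by
    have hs : Complex.cos x * Complex.cos x + Complex.sin x * Complex.sin x = 1 := by
      linear_combination Complex.sin_sq_add_cos_sq x
    simp only [mul_add, sub_mul, mul_smul_comm, smul_mul_assoc, mul_one, one_mul, ha]
    calc _ = (Complex.cos x * Complex.cos x + Complex.sin x * Complex.sin x) • (1 : 𝔸) := by module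
      _ = 1 := by rw [hs, one_smul]
  calc _ = NormedSpace.exp (x • a) * ((Complex.cos x • (1 : 𝔸) - Complex.sin x • a) *
      (Complex.cos x • (1 : 𝔸) + Complex.sin x • a)) := by rw [hr, mul_one]
    _ = _ := by rw [← mul_assoc, hc, one_mul]

/-! ### Trace class operators -/

section TraceClass

variable {ι : Type}

/-- T(x), φ(x) and W(x,x) all end in a factor `E` or `B` on the right, so the left ideal property
suffices for them. -/
lemma IsTraceClass.mul_left {T : Op ι} (hT : IsTraceClass T) (S : Op ι) :
    IsTraceClass (S * T) := by
  obtain ⟨a, b, hs, h⟩ := hT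
  refine ⟨a, fun n => S (b n), ?_, fun v => ?_⟩
  · refine Summable.of_nonneg_of_le (fun n => by positivity) (fun n => ?_) (hs.mul_left ‖S‖)
    calc ‖a n‖ * ‖S (b n)‖ ≤ ‖a n‖ * (‖S‖ * ‖b n‖) := by gcongr; exact S.le_opNorm _
      _ = ‖S‖ * (‖a n‖ * ‖b n‖) := by ring
  · have := S.hasSum (h v)
    simpa using this

end TraceClass

/-! ### Algebra of the block diagonal operators -/

lemma entry_blockDiag (M : ℤ → Matrix (Fin 2) (Fin 2) ℂ) (c : ℝ)
    (hM : ∀ n a b, ‖M n a b‖ ≤ c) (i j : Idx) :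
    entry (blockDiag M c hM) i j = if i.1 = j.1 then M i.1 i.2 j.2 else 0 := by
  obtain ⟨n, a⟩ := i
  obtain ⟨m, b⟩ := j
  rw [entry, blockDiag_apply, Fin.sum_univ_two]
  by_cases h : n = m
  · subst h
    fin_cases b <;> simp [lp.single_apply]
  · simp [lp.single_apply, h]

lemma entry_add {ι : Type} [DecidableEq ι] (S T : Op ι) (i j : ι) :
    entry (S + T) i j = entry S i j + entry T i j := rfl

lemma entry_smul {ι : Type} [DecidableEq ι] (c : ℂ) (T : Op ι) (i j : ι) :
    entry (c • T) i j = c * entry T i j := rfl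

/-- The operator that multiplies the `n`-th block by the scalar `f n`. -/
def blockScalar (f : ℤ → ℂ) (c : ℝ) (hf : ∀ n, ‖f n‖ ≤ c) : Op Idx :=
  blockDiag (fun n => f n • (1 : Matrix (Fin 2) (Fin 2) ℂ)) c (fun n a b => by
    have := (norm_nonneg _).trans (hf n)
    by_cases h : a = b <;> simp [h, hf, this])

lemma blockScalar_apply (f : ℤ → ℂ) (c : ℝ) (hf : ∀ n, ‖f n‖ ≤ c) (v : Ell2 Idx) (p : Idx) :
    (blockScalar f c hf v : Idx → ℂ) p = f p.1 * v p := by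
  obtain ⟨n, a⟩ := p
  rw [blockScalar, blockDiag_apply, Fin.sum_univ_two]
  fin_cases a <;> simp

lemma opA_apply_zero (v : Ell2 Idx) (n : ℤ) : (opA v : Idx → ℂ) (n, 0) = -v (n, 1) := by
  simp [opA, blockDiag_apply, J]

lemma opA_apply_one (v : Ell2 Idx) (n : ℤ) : (opA v : Idx → ℂ) (n, 1) = v (n, 0) := by
  simp [opA, blockDiag_apply, J]

lemma opA_mul_opA : opA * opA = -1 := by
  ext v ⟨n, a⟩
  fin_cases a
  · change (opA (opA v) : Idx → ℂ) (n, 0) = -v (n, 0)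
    rw [opA_apply_zero, opA_apply_one]
  · change (opA (opA v) : Idx → ℂ) (n, 1) = -v (n, 1)
    rw [opA_apply_one, opA_apply_zero]

lemma opA_commute_blockScalar (f : ℤ → ℂ) (c : ℝ) (hf : ∀ n, ‖f n‖ ≤ c) :
    Commute opA (blockScalar f c hf) := by
  ext v ⟨n, a⟩
  fin_cases a
  · change (opA (blockScalar f c hf v) : Idx → ℂ) (n, 0) =
      (blockScalar f c hf (opA v) : Idx → ℂ) (n, 0)
    rw [opA_apply_zero, blockScalar_apply, blockScalar_apply, opA_apply_zero]
    ring
  · change (opA (blockScalar f c hf v) : Idx → ℂ) (n, 1) =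
      (blockScalar f c hf (opA v) : Idx → ℂ) (n, 1)
    rw [opA_apply_one, blockScalar_apply, blockScalar_apply, opA_apply_one]

/-- The scalar `q^{2|n|}` in the `n`-th block of `E`. -/
def coeffE (ω : ℍ) (n : ℤ) : ℂ := nome ω ^ (2 * n.natAbs)

lemma norm_coeffE_le_one (ω : ℍ) (n : ℤ) : ‖coeffE ω n‖ ≤ 1 := by
  rw [coeffE, norm_pow]
  exact pow_le_one₀ (norm_nonneg _) (norm_nome_lt_one ω).le

lemma opE_eq_blockScalar (ω : ℍ) : opE ω = blockScalar (coeffE ω) 1 (norm_coeffE_le_one ω) := rfl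

lemma opA_commute_opE (ω : ℍ) : Commute opA (opE ω) :=
  opA_commute_blockScalar (coeffE ω) 1 (norm_coeffE_le_one ω)

lemma summable_norm_coeffE_nat (ω : ℍ) : Summable fun n : ℕ => ‖coeffE ω n‖ := by
  have h : ‖nome ω‖ ^ 2 < 1 := pow_lt_one₀ (norm_nonneg _) (norm_nome_lt_one ω) two_ne_zero
  refine (summable_geometric_of_lt_one (by positivity) h).congr fun n => ?_
  simp [coeffE, pow_mul]

lemma summable_norm_coeffE (ω : ℍ) : Summable fun n : ℤ => ‖coeffE ω n‖ :=
  Summable.of_nat_of_neg (summable_norm_coeffE_nat ω)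
    ((summable_norm_coeffE_nat ω).congr fun n => by simp [coeffE])

lemma hasSum_coeffE (ω : ℍ) :
    HasSum (coeffE ω) ((1 + nome ω ^ 2) / (1 - nome ω ^ 2)) := by
  have h : ‖nome ω ^ 2‖ < 1 := by
    rw [norm_pow]
    exact pow_lt_one₀ (norm_nonneg _) (norm_nome_lt_one ω) two_ne_zero
  have h0 : 1 - nome ω ^ 2 ≠ 0 := by
    intro h1
    rw [← sub_eq_zero.1 h1] at h
    simp at h
  have hg := hasSum_geometric_of_norm_lt_one h
  have h1 : HasSum (fun n : ℕ => coeffE ω n) (1 - nome ω ^ 2)⁻¹ := by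
    refine hg.congr_fun fun n => ?_
    simp [coeffE, pow_mul]
  have h2 : HasSum (fun n : ℕ => coeffE ω (-(n + 1 : ℤ))) (nome ω ^ 2 * (1 - nome ω ^ 2)⁻¹) := by
    refine (hg.mul_left (nome ω ^ 2)).congr_fun fun n => ?_
    have : (-(n + 1 : ℤ)).natAbs = n + 1 := by omega
    rw [coeffE, this]
    ring
  convert h1.of_nat_of_neg_add_one h2 using 1
  field_simp

lemma hasSum_single_opE (ω : ℍ) (v : Ell2 Idx) :
    HasSum (fun p : Idx => lp.single 2 p (coeffE ω p.1 * v p)) (opE ω v) := by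
  have := lp.hasSum_single (p := 2) (by norm_num) (opE ω v)
  convert this using 3 with p
  rw [opE_eq_blockScalar, blockScalar_apply]

lemma isTraceClass_opE (ω : ℍ) : IsTraceClass (opE ω) := by
  -- The rank-one expansion is the one in the coordinate basis, enumerated because `IsTraceClass`
  -- asks for sequences over ℕ.
  obtain ⟨e⟩ : Nonempty (ℕ ≃ Idx) := nonempty_equiv_of_countable
  refine ⟨fun k => lp.single 2 (e k) (1 : ℂ),
    fun k => coeffE ω (e k).1 • lp.single 2 (e k) (1 : ℂ), ?_, fun v => ?_⟩
  · have hs : Summable fun p : Idx => ‖coeffE ω p.1‖ := by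
      refine (Equiv.prodComm ℤ (Fin 2)).symm.summable_iff.1 ?_
      change Summable fun p : Fin 2 × ℤ => ‖coeffE ω p.2‖
      rw [summable_prod_of_nonneg (fun p => norm_nonneg _)]
      exact ⟨fun _ => summable_norm_coeffE ω, (hasSum_fintype _).summable⟩
    refine (e.summable_iff.2 hs).congr fun k => ?_
    rw [norm_smul, lp.norm_single (by norm_num)]
    simp
  · refine (e.hasSum_iff.2 (hasSum_single_opE ω v)).congr_fun fun k => ?_
    rw [lp.inner_single_left]
    simp only [Function.comp_apply]
    rw [smul_smul, ← lp.single_smul]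
    simp [mul_comm]

/-! ### The group `e^{-xA}` and the operators `T(x)` -/

lemma expNeg_opA (x : ℂ) :
    expNeg opA x = Complex.cos x • (1 : Op Idx) - Complex.sin x • opA := by
  rw [expNeg, ← neg_smul, exp_smul_of_mul_self_eq_neg_one opA_mul_opA]
  simp [sub_eq_add_neg]

lemma expNeg_opA_commute {S : Op Idx} (h : Commute opA S) (x : ℂ) :
    Commute (expNeg opA x) S := by
  rw [expNeg_opA]
  exact ((Commute.one_left S).smul_left _).sub_left (h.smul_left _)

lemma expNeg_opA_mul (x y : ℂ) : expNeg opA x * expNeg opA y = expNeg opA (x + y) := by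
  simp only [expNeg_opA, mul_sub, sub_mul, mul_smul_comm, smul_mul_assoc, mul_one, one_mul,
    opA_mul_opA, Complex.cos_add, Complex.sin_add]
  module

lemma expNeg_opA_add_two_pi (x : ℂ) : expNeg opA (x + 2 * π) = expNeg opA x := by
  rw [expNeg_opA, expNeg_opA, Complex.cos_add_two_pi, Complex.sin_add_two_pi]

lemma opT_eq (ω : ℍ) (x : ℂ) : opT ω x = expNeg opA (2 * x) * opE ω := by
  rw [opT, mul_assoc, ← (expNeg_opA_commute (opA_commute_opE ω) x).eq, ← mul_assoc,
    expNeg_opA_mul, two_mul]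

lemma isTraceClass_opT (ω : ℍ) (x : ℂ) : IsTraceClass (opT ω x) := by
  rw [opT_eq]
  exact (isTraceClass_opE ω).mul_left _

/-- The determinant of the `n`-th block of `I - T(x)`. -/
def blockDet (ω : ℍ) (n : ℤ) (x : ℂ) : ℂ :=
  1 - 2 * coeffE ω n * Complex.cos (2 * x) + coeffE ω n ^ 2

lemma blockDet_eq_mul (ω : ℍ) (n : ℤ) (x : ℂ) :
    blockDet ω n x = (1 - coeffE ω n * Complex.exp (2 * Complex.I * x)) *
      (1 - coeffE ω n * Complex.exp (-(2 * Complex.I * x))) := by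
  have h : Complex.exp (2 * Complex.I * x) * Complex.exp (-(2 * Complex.I * x)) = 1 := by
    rw [← Complex.exp_add]
    simp
  have hc : 2 * Complex.cos (2 * x) =
      Complex.exp (2 * Complex.I * x) + Complex.exp (-(2 * Complex.I * x)) := by
    rw [Complex.two_cos]
    ring_nf
  rw [blockDet]
  linear_combination (-coeffE ω n) * hc - coeffE ω n ^ 2 * h

lemma coeffE_eq_exp (ω : ℍ) (n : ℤ) :
    coeffE ω n = Complex.exp (2 * π * Complex.I * ω * n.natAbs) := by
  rw [coeffE, nome, ← Complex.exp_nat_mul]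
  push_cast
  ring_nf

/-- Here 2πiω|n| + 2ix = 2πik, so x = kπ - |n|πω. -/
lemma mem_lattice_of_coeffE_mul_exp (ω : ℍ) (n : ℤ) (x : ℂ)
    (h : coeffE ω n * Complex.exp (2 * Complex.I * x) = 1) : x ∈ (periods ω).lattice := by
  rw [coeffE_eq_exp, ← Complex.exp_add, Complex.exp_eq_one_iff] at h
  obtain ⟨k, hk⟩ := h
  rw [PeriodPair.mem_lattice]
  refine ⟨k, -n.natAbs, ?_⟩
  have hI : (2 * Complex.I : ℂ) ≠ 0 := by simp
  apply mul_left_cancel₀ hI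
  simp only [periods, Int.cast_neg, Int.cast_natCast]
  linear_combination -hk

lemma blockDet_ne_zero (ω : ℍ) {x : ℂ} (hx : x ∉ (periods ω).lattice) (n : ℤ) :
    blockDet ω n x ≠ 0 := by
  rw [blockDet_eq_mul]
  refine mul_ne_zero (fun h => hx ?_) (fun h => hx ?_)
  · exact mem_lattice_of_coeffE_mul_exp ω n x (sub_eq_zero.1 h).symm
  · rw [← neg_mem_iff]
    refine mem_lattice_of_coeffE_mul_exp ω n (-x) ?_
    rw [mul_neg]
    exact (sub_eq_zero.1 h).symm

lemma tendsto_coeffE (ω : ℍ) : Tendsto (coeffE ω) cofinite (𝓝 0) :=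
  tendsto_zero_iff_norm_tendsto_zero.2 (summable_norm_coeffE ω).tendsto_cofinite_zero

/-- The determinants tend to 1, so their inverses are bounded off a finite set. A vanishing
determinant does no harm since `0⁻¹ = 0`, and no condition on `x` is needed. -/
lemma exists_norm_inv_blockDet_le (ω : ℍ) (x : ℂ) : ∃ c, ∀ n, ‖(blockDet ω n x)⁻¹‖ ≤ c := by
  have h : Tendsto (fun n => ‖(blockDet ω n x)⁻¹‖) cofinite (𝓝 ‖(1 : ℂ)⁻¹‖) := by
    refine (Tendsto.inv₀ ?_ one_ne_zero).norm
    have h1 := tendsto_coeffE ω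
    have := ((((h1.const_mul 2).mul_const (Complex.cos (2 * x))).const_sub 1)).add (h1.pow 2)
    simpa [blockDet] using this
  obtain ⟨c, hc⟩ := h.bddAbove_range_of_cofinite
  exact ⟨c, fun n => hc ⟨n, rfl⟩⟩

/-- The block diagonal operator with blocks `(det (I - T(x))ₙ)⁻¹`. -/
def invBlockDet (ω : ℍ) (x : ℂ) : Op Idx :=
  blockScalar (fun n => (blockDet ω n x)⁻¹) _ (exists_norm_inv_blockDet_le ω x).choose_spec

lemma invBlockDet_apply (ω : ℍ) (x : ℂ) (v : Ell2 Idx) (p : Idx) :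
    (invBlockDet ω x v : Idx → ℂ) p = (blockDet ω p.1 x)⁻¹ * v p :=
  blockScalar_apply _ _ _ v p

lemma opE_apply (ω : ℍ) (v : Ell2 Idx) (p : Idx) :
    (opE ω v : Idx → ℂ) p = coeffE ω p.1 * v p :=
  blockScalar_apply (coeffE ω) 1 (norm_coeffE_le_one ω) v p

lemma opA_commute_invBlockDet (ω : ℍ) (x : ℂ) : Commute opA (invBlockDet ω x) :=
  opA_commute_blockScalar _ _ _

lemma opE_commute_invBlockDet (ω : ℍ) (x : ℂ) : Commute (opE ω) (invBlockDet ω x) := by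
  ext v p
  change (opE ω (invBlockDet ω x v) : Idx → ℂ) p = (invBlockDet ω x (opE ω v) : Idx → ℂ) p
  simp only [opE_apply, invBlockDet_apply]
  ring

lemma opT_commute_invBlockDet (ω : ℍ) (x : ℂ) : Commute (opT ω x) (invBlockDet ω x) := by
  rw [opT_eq]
  exact (expNeg_opA_commute (opA_commute_invBlockDet ω x) _).mul_left
    (opE_commute_invBlockDet ω x)

/-- The adjugate of `I - T(x)`. -/
def adjT (ω : ℍ) (x : ℂ) : Op Idx := 1 - expNeg opA (-(2 * x)) * opE ω

lemma one_sub_opT_commute_adjT (ω : ℍ) (x : ℂ) : Commute (1 - opT ω x) (adjT ω x) := by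
  have hA (y : ℂ) : Commute opA (expNeg opA y) := (expNeg_opA_commute (Commute.refl opA) y).symm
  have hE (y : ℂ) := expNeg_opA_commute (opA_commute_opE ω) y
  rw [adjT, opT_eq]
  refine (Commute.one_left _).sub_left ((Commute.one_right _).sub_right ?_)
  refine Commute.mul_left ?_ ?_
  · exact (expNeg_opA_commute (hA _) _).mul_right (hE _)
  · exact (hE _).symm.mul_right (Commute.refl _)

/-- The cross terms add up to e^{-2xA} + e^{2xA} = 2 cos 2x, and the exponentials cancel in the
product of the two last terms: what remains is the scalar D_n on each block. -/
lemma one_sub_opT_mul_adjT (ω : ℍ) (x : ℂ) : (1 - opT ω x) * adjT ω x =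
    1 - (2 * Complex.cos (2 * x)) • opE ω + opE ω * opE ω := by
  have hE := (expNeg_opA_commute (opA_commute_opE ω) (-(2 * x))).eq
  have h1 : expNeg opA (2 * x) * opE ω * (expNeg opA (-(2 * x)) * opE ω) = opE ω * opE ω := by
    rw [← mul_assoc, mul_assoc (expNeg opA (2 * x)), ← hE, ← mul_assoc (expNeg opA (2 * x)),
      expNeg_opA_mul]
    simp [expNeg_opA]
  rw [adjT, opT_eq, mul_sub, sub_mul, sub_mul, h1]
  simp only [expNeg_opA, Complex.cos_neg, Complex.sin_neg, mul_one, one_mul, sub_mul,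
    smul_mul_assoc]
  module

lemma one_sub_opT_mul_resolvent (ω : ℍ) {x : ℂ} (hx : x ∉ (periods ω).lattice) :
    (1 - opT ω x) * (adjT ω x * invBlockDet ω x) = 1 := by
  rw [← mul_assoc, one_sub_opT_mul_adjT]
  ext v p
  have h := blockDet_ne_zero ω hx p.1
  change (invBlockDet ω x v : Idx → ℂ) p -
    2 * Complex.cos (2 * x) * (opE ω (invBlockDet ω x v) : Idx → ℂ) p +
    (opE ω (opE ω (invBlockDet ω x v)) : Idx → ℂ) p = v p
  simp only [opE_apply, invBlockDet_apply]
  field_simp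
  rw [blockDet]
  ring

lemma resolvent_mul_one_sub_opT (ω : ℍ) {x : ℂ} (hx : x ∉ (periods ω).lattice) :
    (adjT ω x * invBlockDet ω x) * (1 - opT ω x) = 1 := by
  refine Eq.trans (Commute.mul_right (one_sub_opT_commute_adjT ω x) ?_).symm.eq
    (one_sub_opT_mul_resolvent ω hx)
  exact (Commute.one_left _).sub_left (opT_commute_invBlockDet ω x)

lemma isUnit_one_sub_opT (ω : ℍ) {x : ℂ} (hx : x ∉ (periods ω).lattice) :
    IsUnit (1 - opT ω x) :=
  ⟨⟨1 - opT ω x, _, one_sub_opT_mul_resolvent ω hx, resolvent_mul_one_sub_opT ω hx⟩, rfl⟩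

lemma ringInverse_one_sub_opT (ω : ℍ) {x : ℂ} (hx : x ∉ (periods ω).lattice) :
    Ring.inverse (1 - opT ω x) = adjT ω x * invBlockDet ω x :=
  Ring.inverse_unit (⟨1 - opT ω x, _, one_sub_opT_mul_resolvent ω hx,
    resolvent_mul_one_sub_opT ω hx⟩ : (Op Idx)ˣ)

lemma opA_commute_ringInverse (ω : ℍ) {x : ℂ} (hx : x ∉ (periods ω).lattice) :
    Commute opA (Ring.inverse (1 - opT ω x)) := by
  rw [ringInverse_one_sub_opT ω hx, adjT]
  refine Commute.mul_right ?_ (opA_commute_invBlockDet ω x)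
  exact (Commute.one_right _).sub_right
    ((expNeg_opA_commute (Commute.refl opA) _).symm.mul_right (opA_commute_opE ω))

lemma opE_commute_ringInverse (ω : ℍ) {x : ℂ} (hx : x ∉ (periods ω).lattice) :
    Commute (opE ω) (Ring.inverse (1 - opT ω x)) := by
  rw [ringInverse_one_sub_opT ω hx, adjT]
  refine Commute.mul_right ?_ (opE_commute_invBlockDet ω x)
  exact (Commute.one_right _).sub_right
    ((expNeg_opA_commute (opA_commute_opE ω) _).symm.mul_right (Commute.refl _))

/-! ### The linear system and the Gelfand-Levitan equation -/

lemma isPeriodicLinearSystem (ω : ℍ) :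
    IsPeriodicLinearSystem opA (opB ω) opC (opE ω) 1 where
  sign := Or.inl rfl
  BC_eq := by
    rw [opB, opC, one_smul, (opA_commute_opE ω).eq, smul_mul_assoc, two_smul]
  BE_comm := ((Commute.refl (opE ω)).smul_left (2 : ℂ)).eq
  EA_comm := (opA_commute_opE ω).eq.symm
  periodic := by
    rw [exp_smul_of_mul_self_eq_neg_one opA_mul_opA]
    simp

/-- All factors commute; the two copies of `A` give the sign, the two copies of `B = 2E` the factor
4, and `z` occurs in both exponentials, whence 2z. -/
lemma kernel_mul_scattering (ω : ℍ) {x : ℂ} (hx : x ∉ (periods ω).lattice) (y z : ℂ) :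
    W ω x z * phi ω (z + y) = (-4 : ℂ) • (expNeg opA (x + y + 2 * z) *
      (Ring.inverse (1 - opT ω x) * (opE ω * opE ω))) := by
  have hAR := opA_commute_ringInverse ω hx
  have hAE := opA_commute_opE ω
  have hRE := (opE_commute_ringInverse ω hx).symm
  rw [W, phi, kernelW, scattering, opB, opC]
  change opA * expNeg opA x * Ring.inverse (1 - opT ω x) * expNeg opA z * ((2 : ℂ) • opE ω) *
    (opA * expNeg opA (z + y) * ((2 : ℂ) • opE ω)) = _
  set R := Ring.inverse (1 - opT ω x)
  set E := opE ω
  have h1 : opA * expNeg opA x * R * expNeg opA z * E * (opA * expNeg opA (z + y) * E) =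
      opA * opA * (expNeg opA x * expNeg opA z * expNeg opA (z + y)) * (R * (E * E)) := by
    have e1 (w : ℂ) : expNeg opA w * opA = opA * expNeg opA w :=
      (expNeg_opA_commute (Commute.refl _) w).eq
    have e2 (w : ℂ) : R * expNeg opA w = expNeg opA w * R := (expNeg_opA_commute hAR w).eq.symm
    have e3 (w : ℂ) : E * expNeg opA w = expNeg opA w * E := (expNeg_opA_commute hAE w).eq.symm
    have a1 (w : ℂ) (X : Op Idx) : expNeg opA w * (opA * X) = opA * (expNeg opA w * X) := by
      rw [← mul_assoc, e1, mul_assoc]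
    have a2 (w : ℂ) (X : Op Idx) : R * (expNeg opA w * X) = expNeg opA w * (R * X) := by
      rw [← mul_assoc, e2, mul_assoc]
    have a3 (w : ℂ) (X : Op Idx) : E * (expNeg opA w * X) = expNeg opA w * (E * X) := by
      rw [← mul_assoc, e3, mul_assoc]
    have a4 (X : Op Idx) : E * (opA * X) = opA * (E * X) := by
      rw [← mul_assoc, ← hAE.eq, mul_assoc]
    have a5 (X : Op Idx) : R * (opA * X) = opA * (R * X) := by
      rw [← mul_assoc, ← hAR.eq, mul_assoc]
    simp only [mul_assoc, a1, a2, a3, a4, a5]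
  simp only [mul_smul_comm, smul_mul_assoc, smul_smul]
  rw [h1, opA_mul_opA, expNeg_opA_mul, expNeg_opA_mul,
    show x + z + (z + y) = x + y + 2 * z by ring]
  simp only [neg_mul, one_mul]
  norm_num

lemma hasDerivAt_expNeg_opA (w : ℂ) (z : ℝ) :
    HasDerivAt (fun z : ℝ => expNeg opA (w + 2 * z)) ((-2 : ℂ) • (opA * expNeg opA (w + 2 * z)))
      z := by
  have h0 : HasDerivAt (fun z : ℂ => w + 2 * z) 2 z := by
    simpa using ((hasDerivAt_id (z : ℂ)).const_mul 2).const_add w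
  have hc := (h0.ccos.comp_ofReal.smul_const (1 : Op Idx)).sub
    (h0.csin.comp_ofReal.smul_const opA)
  have hf : (fun z : ℝ => expNeg opA (w + 2 * z)) = fun z : ℝ =>
      Complex.cos (w + 2 * z) • (1 : Op Idx) - Complex.sin (w + 2 * z) • opA := by
    funext z
    rw [expNeg_opA]
  rw [hf]
  refine hc.congr_deriv ?_
  rw [expNeg_opA]
  simp only [mul_sub, mul_smul_comm, mul_one, opA_mul_opA]
  module

lemma continuous_kernel_mul_scattering (ω : ℍ) {x : ℂ} (hx : x ∉ (periods ω).lattice) (y : ℂ) :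
    Continuous fun z : ℝ => W ω x z * phi ω (z + y) := by
  simp only [kernel_mul_scattering ω hx]
  have hc : Continuous fun z : ℝ => expNeg opA (x + y + 2 * z) :=
    continuous_iff_continuousAt.2 fun z => (hasDerivAt_expNeg_opA (x + y) z).continuousAt
  exact (hc.mul continuous_const).const_smul (-4 : ℂ)

/-- Differentiating e^{-(x+y+2z)A} brings down -2A, so -2A e^{-(x+y+2z)A} R E² is a primitive of the
integrand, because `A * A = -1`. -/
lemma integral_kernel_mul_scattering (ω : ℍ) {x : ℝ} (hx : (x : ℂ) ∉ (periods ω).lattice)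
    (y : ℂ) :
    ∫ z : ℝ in x..2 * π, W ω x z * phi ω (z + y) =
      (-2 : ℂ) • ((opA * expNeg opA (x + y)) *
        (Ring.inverse (1 - opT ω x) * (opE ω * opE ω))) -
      (-2 : ℂ) • ((opA * expNeg opA (x + y + 2 * x)) *
        (Ring.inverse (1 - opT ω x) * (opE ω * opE ω))) := by
  have hd (z : ℝ) : HasDerivAt (fun z : ℝ => (-2 : ℂ) • ((opA * expNeg opA (x + y + 2 * z)) *
        (Ring.inverse (1 - opT ω x) * (opE ω * opE ω)))) (W ω x z * phi ω (z + y)) z := by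
    rw [kernel_mul_scattering ω hx]
    refine ((((hasDerivAt_expNeg_opA (x + y) z).const_mul opA).mul_const
      (Ring.inverse (1 - opT ω x) * (opE ω * opE ω))).const_smul (-2 : ℂ)).congr_deriv ?_
    rw [mul_smul_comm, ← mul_assoc opA opA, opA_mul_opA, neg_one_mul, smul_mul_assoc, neg_mul]
    module
  rw [intervalIntegral.integral_eq_sub_of_hasDerivAt (fun z _ => hd z)
    ((continuous_kernel_mul_scattering ω hx y).intervalIntegrable _ _)]
  -- The upper endpoint shifts the exponent by 4π, two periods.
  have hp : expNeg opA (x + y + 2 * (2 * π : ℝ)) = expNeg opA (x + y) := by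
    rw [← expNeg_opA_add_two_pi (x + y), ← expNeg_opA_add_two_pi (x + y + 2 * π)]
    push_cast
    ring_nf
  rw [hp]

/-- The upper endpoint of the primitive is -W(x,y)E. By T R = R - 1 the lower one is φ(x+y) -
W(x,y), so the integral equals W(x,y) - φ(x+y) - W(x,y)E. -/
lemma gelfand_levitan (ω : ℍ) {x : ℝ} (hx : (x : ℂ) ∉ (periods ω).lattice) (y : ℂ) :
    -phi ω (x + y) + W ω x y - (∫ z : ℝ in x..2 * π, W ω x z * phi ω (z + y)) =
      W ω x y * opE ω := by
  rw [integral_kernel_mul_scattering ω hx]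
  have hAR := opA_commute_ringInverse ω hx
  have hRE := (opE_commute_ringInverse ω hx).symm
  have hW : W ω x y = (2 : ℂ) •
      (opA * expNeg opA (x + y) * (Ring.inverse (1 - opT ω x) * opE ω)) := by
    rw [W, kernelW, opB, opC]
    change opA * expNeg opA x * Ring.inverse (1 - opT ω x) * expNeg opA y * ((2 : ℂ) • opE ω) = _
    rw [mul_smul_comm, mul_assoc (opA * expNeg opA x), ← (expNeg_opA_commute hAR y).eq,
      ← expNeg_opA_mul]
    simp only [mul_assoc]
  have hphi : phi ω (x + y) = (2 : ℂ) • (opA * expNeg opA (x + y) * opE ω) := by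
    rw [phi, scattering, opB, opC, mul_smul_comm]
  have hR : Ring.inverse (1 - opT ω x) * opE ω - opE ω = expNeg opA (2 * x) *
      (Ring.inverse (1 - opT ω x) * (opE ω * opE ω)) := by
    have h := Ring.mul_inverse_cancel _ (isUnit_one_sub_opT ω hx)
    rw [sub_mul, one_mul, opT_eq, sub_eq_iff_eq_add, ← opT_eq] at h
    have h2 : expNeg opA (2 * x) * opE ω * Ring.inverse (1 - opT ω x) * opE ω =
        expNeg opA (2 * x) * (Ring.inverse (1 - opT ω x) * (opE ω * opE ω)) := by
      rw [mul_assoc (expNeg opA (2 * x)), ← hRE.eq]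
      simp only [mul_assoc]
    rw [← h2]
    nth_rewrite 1 [h]
    rw [add_mul, one_mul, add_sub_cancel_left, opT_eq]
  have h3 : opA * expNeg opA (x + y + 2 * x) *
      (Ring.inverse (1 - opT ω x) * (opE ω * opE ω)) = opA * expNeg opA (x + y) *
      (Ring.inverse (1 - opT ω x) * opE ω) - opA * expNeg opA (x + y) * opE ω := by
    rw [← mul_sub, hR, ← expNeg_opA_mul (x + y)]
    simp only [mul_assoc]
  rw [h3, hW, hphi, smul_mul_assoc]
  simp only [mul_assoc]
  module

/-! ### Traces -/

/-- `J` has zero diagonal, so the part along `A` never contributes to a trace. -/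
lemma entry_diag_of_scalar {S : Op Idx} {f : ℤ → ℂ}
    (hS : ∀ (v : Ell2 Idx) (p : Idx), (S v : Idx → ℂ) p = f p.1 * v p) (α β : ℂ) (i : Idx) :
    entry ((α • opA + β • (1 : Op Idx)) * S) i i = β * f i.1 := by
  obtain ⟨n, a⟩ := i
  rw [entry]
  set v : Ell2 Idx := lp.single 2 (n, a) (1 : ℂ) with hv
  change α * (opA (S v) : Idx → ℂ) (n, a) + β * (S v : Idx → ℂ) (n, a) = _
  fin_cases a
  · simp only [Fin.zero_eta, opA_apply_zero, hS, hv]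
    simp [lp.single_apply]
  · simp only [Fin.mk_one, opA_apply_one, hS, hv]
    simp [lp.single_apply]

lemma hasSum_idx_of_summable_norm {g : ℤ → ℂ} {s : ℂ} (hg : Summable fun n => ‖g n‖)
    (hs : HasSum g s) : HasSum (fun i : Idx => g i.1) (2 * s) := by
  have h0 : Summable fun p : Fin 2 × ℤ => g p.2 := by
    refine Summable.of_norm ?_
    rw [summable_prod_of_nonneg (fun p => norm_nonneg _)]
    exact ⟨fun _ => hg, (hasSum_fintype _).summable⟩
  have h1 := (h0.hasSum.prod_fiberwise (fun _ => hs)).unique (hasSum_fintype fun _ : Fin 2 => s)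
  rw [Fin.sum_univ_two, ← two_mul] at h1
  rw [← h1]
  exact (Equiv.prodComm ℤ (Fin 2)).hasSum_iff.2 h0.hasSum

lemma opA_mul_expNeg (x : ℂ) :
    opA * expNeg opA x = Complex.cos x • opA + Complex.sin x • (1 : Op Idx) := by
  rw [expNeg_opA, mul_sub, mul_smul_comm, mul_smul_comm, opA_mul_opA, mul_one]
  module

lemma opB_apply (ω : ℍ) (v : Ell2 Idx) (p : Idx) :
    (opB ω v : Idx → ℂ) p = 2 * coeffE ω p.1 * v p := by
  change 2 * (opE ω v : Idx → ℂ) p = _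
  rw [opE_apply, mul_assoc]

lemma isTraceClass_opB (ω : ℍ) : IsTraceClass (opB ω) := by
  have : opB ω = ((2 : ℂ) • (1 : Op Idx)) * opE ω := by rw [opB, smul_mul_assoc, one_mul]
  rw [this]
  exact (isTraceClass_opE ω).mul_left _

lemma hasTrace_phi (ω : ℍ) (x : ℂ) : HasTrace (phi ω x)
    (4 * ((1 + nome ω ^ 2) / (1 - nome ω ^ 2)) * Complex.sin x) := by
  refine ⟨(isTraceClass_opB ω).mul_left _, ?_⟩
  have h := hasSum_idx_of_summable_norm
    (((summable_norm_coeffE ω).mul_left (‖2 * Complex.sin x‖)).congr fun n => (norm_mul _ _).symm)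
    ((hasSum_coeffE ω).mul_left (2 * Complex.sin x))
  convert h using 1
  · funext i
    rw [phi, scattering, opC, opA_mul_expNeg, 
      entry_diag_of_scalar (f := fun n => 2 * coeffE ω n) (opB_apply ω)]
    ring
  · ring

lemma summable_norm_coeffE_mul_inv_blockDet (ω : ℍ) (x : ℂ) :
    Summable fun n => ‖coeffE ω n * (blockDet ω n x)⁻¹‖ := by
  obtain ⟨c, hc⟩ := exists_norm_inv_blockDet_le ω x
  refine Summable.of_nonneg_of_le (fun n => norm_nonneg _) (fun n => ?_)
    ((summable_norm_coeffE ω).mul_right c)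
  rw [norm_mul]
  gcongr
  exact hc n

lemma entry_kernel_diag (ω : ℍ) {x : ℂ} (hx : x ∉ (periods ω).lattice) (i : Idx) :
    entry (W ω x x) i i =
      2 * Complex.sin (2 * x) * (coeffE ω i.1 * (blockDet ω i.1 x)⁻¹) := by
  -- Multiplying the adjugate by e^{-2xA} gives e^{-2xA} - E. After the factor `A`, the term in E is
  -- a block-scalar multiple of `A` and is invisible on the diagonal.
  have hW : W ω x x = (Complex.cos (2 * x) • opA + Complex.sin (2 * x) • (1 : Op Idx)) *
      (invBlockDet ω x * opB ω) +
      ((-1 : ℂ) • opA + (0 : ℂ) • (1 : Op Idx)) * (opE ω * (invBlockDet ω x * opB ω)) := by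
    have hA := (opA_commute_ringInverse ω hx)
    rw [W, kernelW, opC]
    change opA * expNeg opA x * Ring.inverse (1 - opT ω x) * expNeg opA x * opB ω = _
    have h0 : expNeg opA (2 * x) * expNeg opA (-(2 * x)) = 1 := by
      rw [expNeg_opA_mul]
      simp [expNeg_opA]
    have h1 : expNeg opA (2 * x) * ((1 - expNeg opA (-(2 * x)) * opE ω) * invBlockDet ω x) =
        expNeg opA (2 * x) * invBlockDet ω x - opE ω * invBlockDet ω x := by
      rw [sub_mul, one_mul, mul_sub, mul_assoc (expNeg opA (-(2 * x))),
        ← mul_assoc (expNeg opA (2 * x)) (expNeg opA (-(2 * x))), h0, one_mul]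
    rw [mul_assoc (opA * expNeg opA x), ← (expNeg_opA_commute hA x).eq, mul_assoc opA,
      ← mul_assoc (expNeg opA x), expNeg_opA_mul, ← two_mul, ringInverse_one_sub_opT ω hx, adjT,
      h1, ← opA_mul_expNeg, zero_smul, add_zero, neg_one_smul, neg_mul, mul_sub, sub_mul,
      sub_eq_add_neg]
    simp only [mul_assoc]
  rw [hW, entry_add,
    entry_diag_of_scalar (f := fun n => (blockDet ω n x)⁻¹ * (2 * coeffE ω n)) (fun v p => ?_),
    entry_diag_of_scalar
      (f := fun n => coeffE ω n * ((blockDet ω n x)⁻¹ * (2 * coeffE ω n))) (fun v p => ?_)]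
  · ring
  · change (opE ω (invBlockDet ω x (opB ω v)) : Idx → ℂ) p = _
    rw [opE_apply, invBlockDet_apply, opB_apply]
    ring
  · change (invBlockDet ω x (opB ω v) : Idx → ℂ) p = _
    rw [invBlockDet_apply, opB_apply]
    ring

lemma hasTrace_kernel (ω : ℍ) {x : ℂ} (hx : x ∉ (periods ω).lattice) :
    HasTrace (W ω x x)
      (∑' n, 4 * Complex.sin (2 * x) * (coeffE ω n * (blockDet ω n x)⁻¹)) := by
  refine ⟨(isTraceClass_opB ω).mul_left _, ?_⟩
  have hs := (summable_norm_coeffE_mul_inv_blockDet ω x).mul_left ‖2 * Complex.sin (2 * x)‖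
  simp only [← norm_mul] at hs
  have h := hasSum_idx_of_summable_norm hs hs.of_norm.hasSum
  convert h using 1
  · funext i
    rw [entry_kernel_diag ω hx]
  · rw [← tsum_mul_left]
    refine tsum_congr fun n => ?_
    ring

/-! ### The Fredholm determinant -/

lemma entry_opT (ω : ℍ) (x : ℂ) (i j : Idx) :
    entry (opT ω x) i j = if i.1 = j.1 then coeffE ω i.1 *
      (Complex.cos (2 * x) * (1 : Matrix (Fin 2) (Fin 2) ℂ) i.2 j.2 -
        Complex.sin (2 * x) * J i.2 j.2) else 0 := by
  have h : opT ω x = Complex.cos (2 * x) • opE ω + (-Complex.sin (2 * x)) • (opE ω * opA) := by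
    rw [opT_eq, expNeg_opA, sub_mul, smul_mul_assoc, one_mul, smul_mul_assoc,
      (opA_commute_opE ω).eq, neg_smul, sub_eq_add_neg]
  have hE : entry (opE ω) i j =
      if i.1 = j.1 then coeffE ω i.1 * (1 : Matrix (Fin 2) (Fin 2) ℂ) i.2 j.2 else 0 := by
    rw [opE, entry_blockDiag]
    simp [coeffE]
  have hEA : entry (opE ω * opA) i j = if i.1 = j.1 then coeffE ω i.1 * J i.2 j.2 else 0 := by
    change (opE ω (opA (lp.single 2 j (1 : ℂ))) : Idx → ℂ) i = _
    rw [opE_apply]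
    change coeffE ω i.1 * entry opA i j = _
    rw [opA, entry_blockDiag]
    split_ifs <;> simp
  rw [h, entry_add, entry_smul, entry_smul, hE, hEA]
  split_ifs <;> ring

/-- A finite section may cut a block in half; such a block leaves one diagonal entry instead of its
determinant. -/
lemma sectionDet_opT (ω : ℍ) (x : ℂ) (F : Finset Idx) :
    sectionDet (opT ω x) F = ∏ n ∈ F.image Prod.fst,
      if (n, 0) ∈ F ∧ (n, 1) ∈ F then blockDet ω n x
      else 1 - coeffE ω n * Complex.cos (2 * x) := by
  rw [sectionDet]
  set M : Matrix {k // k ∈ F} {k // k ∈ F} ℂ :=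
    1 - Matrix.of fun i j : {k // k ∈ F} => entry (opT ω x) i j with hM
  have hMij (i j : {k // k ∈ F}) : M i j = (1 : Matrix {k // k ∈ F} {k // k ∈ F} ℂ) i j -
      entry (opT ω x) i j := rfl
  have hb : M.BlockTriangular fun i => i.1.1 := by
    intro i j hij
    rw [hMij, entry_opT, if_neg hij.ne', Matrix.one_apply_ne, sub_zero]
    rintro rfl
    exact lt_irrefl _ hij
  rw [hb.det]
  have himg : Finset.univ.image (fun i : {k // k ∈ F} => i.1.1) = F.image Prod.fst := by
    ext n
    simp
  rw [himg]
  refine Finset.prod_congr rfl fun n hn => ?_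
  split_ifs with h
  · let e : Fin 2 ≃ {i : {k // k ∈ F} // i.1.1 = n} :=
      { toFun := fun a => ⟨⟨(n, a), by fin_cases a; exacts [h.1, h.2]⟩, rfl⟩
        invFun := fun i => i.1.1.2
        left_inv := fun a => rfl
        right_inv := by
          rintro ⟨⟨⟨m, a⟩, hm⟩, rfl⟩
          rfl }
    rw [← Matrix.det_submatrix_equiv_self e, Matrix.det_fin_two]
    have hs := Complex.sin_sq_add_cos_sq (2 * x)
    have hne : ¬ (0 : Fin 2) = 1 := by decide
    simp only [Matrix.submatrix_apply, Matrix.toSquareBlock_def, Matrix.of_apply, hMij, entry_opT,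
      e, Equiv.coe_fn_mk, Matrix.one_apply, Subtype.mk.injEq, Prod.mk.injEq, hne, J, blockDet]
    simp
    linear_combination coeffE ω n ^ 2 * hs
  · obtain ⟨⟨m, a⟩, hp, rfl⟩ := Finset.mem_image.1 hn
    have hu (i : {i : {k // k ∈ F} // i.1.1 = m}) : i = ⟨⟨(m, a), hp⟩, rfl⟩ := by
      obtain ⟨⟨⟨k, b⟩, hk⟩, hkm⟩ := i
      obtain rfl : k = m := hkm
      have : b = a := by
        by_contra hne
        have key : ∀ a b : Fin 2, b ≠ a → (k, a) ∈ F → (k, b) ∈ F →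
            (k, 0) ∈ F ∧ (k, 1) ∈ F := by
          simp only [Fin.forall_fin_two]
          tauto
        exact h (key a b hne hp hk)
      subst this
      rfl
    let _ : Unique {i : {k // k ∈ F} // i.1.1 = m} := ⟨⟨⟨⟨(m, a), hp⟩, rfl⟩⟩, hu⟩
    rw [Matrix.det_unique]
    have hJ : J a a = 0 := by fin_cases a <;> simp [J]
    change M ⟨(m, a), hp⟩ ⟨(m, a), hp⟩ = _
    rw [hMij, entry_opT]
    simp [hJ]

lemma summable_norm_blockDet_sub_one (ω : ℍ) (x : ℂ) :
    Summable fun n => ‖-(2 * coeffE ω n * Complex.cos (2 * x)) + coeffE ω n ^ 2‖ := by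
  refine Summable.of_nonneg_of_le (fun n => norm_nonneg _) (fun n => ?_)
    ((summable_norm_coeffE ω).mul_right (2 * ‖Complex.cos (2 * x)‖ + 1))
  refine (norm_add_le _ _).trans ?_
  rw [norm_neg, norm_mul, norm_mul, norm_pow, mul_add, mul_one]
  have h1 := norm_coeffE_le_one ω n
  have h2 : ‖coeffE ω n‖ ^ 2 ≤ ‖coeffE ω n‖ := by nlinarith [norm_nonneg (coeffE ω n)]
  simp only [Complex.norm_ofNat]
  linarith

lemma blockDet_eq_one_add (ω : ℍ) (n : ℤ) (x : ℂ) : blockDet ω n x =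
    1 + (-(2 * coeffE ω n * Complex.cos (2 * x)) + coeffE ω n ^ 2) := by
  rw [blockDet]
  ring

lemma multipliable_blockDet (ω : ℍ) (x : ℂ) : Multipliable fun n => blockDet ω n x := by
  simp only [blockDet_eq_one_add]
  exact multipliable_one_add_of_summable (summable_norm_blockDet_sub_one ω x)

/-- Once F contains both indices of every block in a finite set S, the complete blocks include S and
the halved ones avoid it. The complete blocks thus give the infinite product, and the halved ones a
factor tending to 1 by absolute summability. -/
lemma tendsto_sectionDet_opT (ω : ℍ) (x : ℂ) :
    Tendsto (sectionDet (opT ω x)) atTop (𝓝 (∏' n, blockDet ω n x)) := by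
  set full : Finset Idx → Finset ℤ := fun F =>
    (F.image Prod.fst).filter fun n => (n, 0) ∈ F ∧ (n, 1) ∈ F with hfull
  set part : Finset Idx → Finset ℤ := fun F =>
    (F.image Prod.fst).filter fun n => ¬((n, 0) ∈ F ∧ (n, 1) ∈ F) with hpart
  have hsplit (F : Finset Idx) : sectionDet (opT ω x) F = (∏ n ∈ full F, blockDet ω n x) *
      ∏ n ∈ part F, (1 + -(coeffE ω n * Complex.cos (2 * x))) := by
    rw [sectionDet_opT, Finset.prod_ite]
    simp only [sub_eq_add_neg, hfull, hpart]
  have hmem (S : Finset ℤ) {F : Finset Idx} (hF : S ×ˢ Finset.univ ≤ F) {n : ℤ} (hn : n ∈ S) :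
      (n, 0) ∈ F ∧ (n, 1) ∈ F := ⟨hF (by simp [hn]), hF (by simp [hn])⟩
  have h1 : Tendsto (fun F => ∏ n ∈ full F, blockDet ω n x) atTop
      (𝓝 (∏' n, blockDet ω n x)) := by
    refine Tendsto.comp (f := full) (multipliable_blockDet ω x).hasProd ?_
    refine tendsto_atTop.2 fun S => ?_
    filter_upwards [eventually_ge_atTop (S ×ˢ (Finset.univ : Finset (Fin 2)))] with F hF n hn
    exact Finset.mem_filter.2 ⟨Finset.mem_image.2 ⟨(n, 0), (hmem S hF hn).1, rfl⟩, hmem S hF hn⟩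
  have h2 : Tendsto (fun F => ∏ n ∈ part F, (1 + -(coeffE ω n * Complex.cos (2 * x)))) atTop
      (𝓝 1) := by
    have hs : Summable fun n => ‖-(coeffE ω n * Complex.cos (2 * x))‖ := by
      simpa only [norm_neg, norm_mul] using
        (summable_norm_coeffE ω).mul_right ‖Complex.cos (2 * x)‖
    refine Metric.tendsto_nhds.2 fun ε hε => ?_
    obtain ⟨S, hS⟩ := prod_vanishing_of_summable_norm hs hε
    filter_upwards [eventually_ge_atTop (S ×ˢ (Finset.univ : Finset (Fin 2)))] with F hF
    rw [dist_eq_norm]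
    refine hS _ (Finset.disjoint_left.2 fun n hn hnS => ?_)
    exact (Finset.mem_filter.1 hn).2 (hmem S hF hnS)
  have := h1.mul h2
  rw [mul_one] at this
  exact this.congr fun F => (hsplit F).symm

lemma tauFun_eq_tprod (ω : ℍ) (x : ℂ) : tauFun ω x = ∏' n, blockDet ω n x :=
  (tendsto_sectionDet_opT ω x).limUnder_eq

lemma hasFredholmDet_opT (ω : ℍ) (x : ℂ) : HasFredholmDet (opT ω x) (tauFun ω x) := by
  refine ⟨isTraceClass_opT ω x, ?_⟩
  rw [tauFun_eq_tprod]
  exact tendsto_sectionDet_opT ω x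

lemma tauFun_ne_zero (ω : ℍ) {x : ℂ} (hx : x ∉ (periods ω).lattice) : tauFun ω x ≠ 0 := by
  rw [tauFun_eq_tprod]
  simp only [blockDet_eq_one_add]
  refine tprod_one_add_ne_zero_of_summable (fun n => ?_) (summable_norm_blockDet_sub_one ω x)
  rw [← blockDet_eq_one_add]
  exact blockDet_ne_zero ω hx n

/-! ### Jacobi's triple product -/

/-- The finite product `∏_{k=1}^{n} (1 - p^k)`. -/
def qPoch (p : ℂ) (n : ℕ) : ℂ := ∏ k ∈ Finset.range n, (1 - p ^ (k + 1))

lemma qPoch_succ (p : ℂ) (n : ℕ) : qPoch p (n + 1) = qPoch p n * (1 - p ^ (n + 1)) :=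
  Finset.prod_range_succ _ _

/-- The reciprocal of `qPoch`, extended by zero to the negative integers. -/
def invQPoch (p : ℂ) (m : ℤ) : ℂ := if 0 ≤ m then (qPoch p m.toNat)⁻¹ else 0

lemma one_sub_pow_succ_ne_zero {p : ℂ} (hp : ‖p‖ < 1) (n : ℕ) : 1 - p ^ (n + 1) ≠ 0 := by
  intro h
  have h1 : ‖p ^ (n + 1)‖ < 1 := by
    rw [norm_pow]
    exact pow_lt_one₀ (norm_nonneg _) hp n.succ_ne_zero
  rw [← sub_eq_zero.1 h] at h1
  simp at h1

lemma qPoch_ne_zero {p : ℂ} (hp : ‖p‖ < 1) (n : ℕ) : qPoch p n ≠ 0 :=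
  Finset.prod_ne_zero_iff.2 fun k _ => one_sub_pow_succ_ne_zero hp k

lemma invQPoch_natCast (p : ℂ) (n : ℕ) : invQPoch p n = (qPoch p n)⁻¹ := by
  simp [invQPoch]

/-- Extension by zero makes the recursion hold at every integer (at m = 0 both sides vanish), so the
sums below need no boundary terms. -/
lemma invQPoch_sub_one {p : ℂ} (hp : ‖p‖ < 1) (m : ℤ) :
    invQPoch p (m - 1) = (1 - p ^ m) * invQPoch p m := by
  rcases lt_trichotomy m 0 with h | h | h
  · rw [invQPoch, invQPoch, if_neg (by omega), if_neg (by omega), mul_zero]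
  · subst h
    simp [invQPoch]
  · obtain ⟨n, rfl⟩ : ∃ n : ℕ, m = n + 1 := ⟨(m - 1).toNat, by omega⟩
    rw [add_sub_cancel_right, invQPoch_natCast, ← Nat.cast_succ, invQPoch_natCast, zpow_natCast,
      Nat.succ_eq_add_one, qPoch_succ]
    have h1 := one_sub_pow_succ_ne_zero hp n
    have h2 := qPoch_ne_zero hp n
    field_simp

/-- The coefficients are the Gaussian binomials of 2N over N + j, and G j is (-u)^j p^{j(j+1)/2},
described by its recursion. The step from N to N + 1 multiplies by (1 - u p^{N+1})(1 - u⁻¹ p^N). -/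
lemma hasSum_finite_triple_product {p u : ℂ} (hp : ‖p‖ < 1) (hp0 : p ≠ 0) (hu : u ≠ 0)
    {G : ℤ → ℂ} (hG0 : G 0 = 1) (hG : ∀ j, G (j + 1) = -u * p ^ (j + 1) * G j) (N : ℕ) :
    HasSum (fun j : ℤ => qPoch p (2 * N) * invQPoch p (N + j) * invQPoch p (N - j) * G j)
      (∏ k ∈ Finset.range N, (1 - u * p ^ (k + 1)) * (1 - u⁻¹ * p ^ k)) := by
  induction N with
  | zero =>
    have := hasSum_single (f := fun j : ℤ => qPoch p (2 * 0) * invQPoch p ((0 : ℕ) + j) *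
      invQPoch p ((0 : ℕ) - j) * G j) 0 (fun j hj => by
        rcases lt_or_gt_of_ne hj with h | h
        · simp [invQPoch, h]
        · simp [invQPoch, h])
    simpa [invQPoch, qPoch, hG0] using this
  | succ N ih =>
    set f : ℤ → ℂ := fun j =>
      qPoch p (2 * N) * invQPoch p (N + j) * invQPoch p (N - j) * G j with hf
    have hl := (Equiv.subRight (1 : ℤ)).hasSum_iff.2 ih
    have hr := (Equiv.addRight (1 : ℤ)).hasSum_iff.2 ih
    -- The new factor expands to 1 + p^{2N+1} - u p^{N+1} - u⁻¹ p^N; the terms in u and u⁻¹ are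
    -- absorbed by shifting j.
    have h := ((ih.mul_left (1 + p ^ (2 * N + 1))).sub (hl.mul_left (u * p ^ (N + 1)))).sub
      (hr.mul_left (u⁻¹ * p ^ N))
    have hval : ∏ k ∈ Finset.range (N + 1), (1 - u * p ^ (k + 1)) * (1 - u⁻¹ * p ^ k) =
        (1 + p ^ (2 * N + 1)) * ∏ k ∈ Finset.range N, (1 - u * p ^ (k + 1)) * (1 - u⁻¹ * p ^ k) -
        u * p ^ (N + 1) * ∏ k ∈ Finset.range N, (1 - u * p ^ (k + 1)) * (1 - u⁻¹ * p ^ k) -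
        u⁻¹ * p ^ N * ∏ k ∈ Finset.range N, (1 - u * p ^ (k + 1)) * (1 - u⁻¹ * p ^ k) := by
      rw [Finset.prod_range_succ]
      field_simp
      ring
    rw [hval]
    refine HasSum.congr_fun h fun j => ?_
    simp only [hf, Function.comp_apply, Equiv.subRight_apply, Equiv.coe_addRight]
    have a1 : invQPoch p (N + j) = (1 - p ^ ((N : ℤ) + 1 + j)) * invQPoch p (N + 1 + j) := by
      rw [← invQPoch_sub_one hp]
      ring_nf
    have a2 : invQPoch p (N - j) = (1 - p ^ ((N : ℤ) + 1 - j)) * invQPoch p (N + 1 - j) := by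
      rw [← invQPoch_sub_one hp]
      ring_nf
    have a3 : invQPoch p (N + (j - 1)) = (1 - p ^ ((N : ℤ) + j)) * invQPoch p (N + j) := by
      rw [← invQPoch_sub_one hp]
      ring_nf
    have a4 : invQPoch p (N - (j + 1)) = (1 - p ^ ((N : ℤ) - j)) * invQPoch p (N - j) := by
      rw [← invQPoch_sub_one hp]
      ring_nf
    have a5 : (N : ℤ) - (j - 1) = N + 1 - j := by ring
    have a6 : (N : ℤ) + (j + 1) = N + 1 + j := by ring
    have g1 : G j = -u * p ^ j * G (j - 1) := by
      have := hG (j - 1)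
      rwa [sub_add_cancel] at this
    have q1 : qPoch p (2 * (N + 1)) =
        qPoch p (2 * N) * (1 - p ^ (2 * N + 1)) * (1 - p ^ (2 * N + 2)) := by
      rw [show 2 * (N + 1) = 2 * N + 1 + 1 by ring, qPoch_succ, qPoch_succ]
    -- Everything is now expressed through the reciprocals at N + 1 ± j and through G (j - 1),
    -- leaving a rational identity in p^j and p^N.
    rw [a3, a4, a5, a6, a1, a2, hG j, g1, q1]
    push_cast
    simp only [zpow_add₀ hp0, zpow_sub₀ hp0, zpow_natCast, zpow_one, pow_add, pow_mul', pow_one]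
    have hX : p ^ j ≠ 0 := zpow_ne_zero _ hp0
    generalize p ^ j = X at *
    generalize p ^ N = y at *
    generalize invQPoch p (N + 1 + j) = R₁ at *
    generalize invQPoch p (N + 1 - j) = R₂ at *
    field_simp
    ring

lemma summable_norm_pow_succ {p : ℂ} (hp : ‖p‖ < 1) : Summable fun n : ℕ => ‖-p ^ (n + 1)‖ := by
  simp only [norm_neg, norm_pow]
  exact (summable_nat_add_iff 1).2 (summable_geometric_of_lt_one (norm_nonneg _) hp)

lemma tendsto_qPoch {p : ℂ} (hp : ‖p‖ < 1) :
    Tendsto (qPoch p) atTop (𝓝 (∏' n : ℕ, (1 - p ^ (n + 1)))) := by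
  have := (multipliable_one_add_of_summable (summable_norm_pow_succ hp)).hasProd.tendsto_prod_nat
  simp only [← sub_eq_add_neg] at this
  exact this

lemma tprod_one_sub_pow_ne_zero {p : ℂ} (hp : ‖p‖ < 1) : ∏' n : ℕ, (1 - p ^ (n + 1)) ≠ 0 := by
  simp only [sub_eq_add_neg]
  refine tprod_one_add_ne_zero_of_summable (fun n => ?_) (summable_norm_pow_succ hp)
  rw [← sub_eq_add_neg]
  exact one_sub_pow_succ_ne_zero hp n

lemma tendsto_invQPoch {p : ℂ} (hp : ‖p‖ < 1) :
    Tendsto (invQPoch p) atTop (𝓝 (∏' n : ℕ, (1 - p ^ (n + 1)))⁻¹) := by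
  have ht : Tendsto Int.toNat atTop atTop := tendsto_atTop.2 fun b => by
    filter_upwards [eventually_ge_atTop (b : ℤ)] with m hm
    omega
  have h := ((tendsto_qPoch hp).comp ht).inv₀ (tprod_one_sub_pow_ne_zero hp)
  refine h.congr' ?_
  filter_upwards [eventually_ge_atTop 0] with m hm
  simp [invQPoch, hm]

lemma exists_norm_invQPoch_le {p : ℂ} (hp : ‖p‖ < 1) : ∃ c, ∀ m, ‖invQPoch p m‖ ≤ c := by
  have h := ((tendsto_invQPoch hp).comp tendsto_natCast_atTop_atTop).norm.bddAbove_range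
  obtain ⟨c, hc⟩ := h
  refine ⟨max c 0, fun m => ?_⟩
  rcases le_or_gt 0 m with hm | hm
  · lift m to ℕ using hm
    exact (hc ⟨m, rfl⟩).trans (le_max_left _ _)
  · simp [invQPoch, hm]

/-- Let N → ∞ in the finite form: each Gaussian binomial tends to the inverse of ∏ (1 - p^n) and is
bounded uniformly in N and j, so dominated convergence applies. -/
lemma tendsto_triple_product {p u : ℂ} (hp : ‖p‖ < 1) (hp0 : p ≠ 0) (hu : u ≠ 0)
    {G : ℤ → ℂ} (hG0 : G 0 = 1) (hG : ∀ j, G (j + 1) = -u * p ^ (j + 1) * G j)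
    (hs : Summable fun j => ‖G j‖) :
    Tendsto (fun N => ∏ k ∈ Finset.range N, (1 - u * p ^ (k + 1)) * (1 - u⁻¹ * p ^ k)) atTop
      (𝓝 ((∏' n : ℕ, (1 - p ^ (n + 1)))⁻¹ * ∑' j, G j)) := by
  obtain ⟨c, hc⟩ := exists_norm_invQPoch_le hp
  obtain ⟨d, hd⟩ := (tendsto_qPoch hp).norm.bddAbove_range
  have hd' (n : ℕ) : ‖qPoch p n‖ ≤ d := hd ⟨n, rfl⟩
  have hc0 : 0 ≤ c := (norm_nonneg _).trans (hc 0)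
  have hd0 : 0 ≤ d := (norm_nonneg _).trans (hd' 0)
  have h2 : Tendsto (fun N : ℕ => 2 * N) atTop atTop :=
    tendsto_id.const_mul_atTop' two_pos
  have h := tendsto_tsum_of_dominated_convergence (𝓕 := atTop)
    (f := fun (N : ℕ) (j : ℤ) =>
      qPoch p (2 * N) * invQPoch p (N + j) * invQPoch p (N - j) * G j)
    (g := fun j => (∏' n : ℕ, (1 - p ^ (n + 1))) * (∏' n : ℕ, (1 - p ^ (n + 1)))⁻¹ *
      (∏' n : ℕ, (1 - p ^ (n + 1)))⁻¹ * G j)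
    (bound := fun j => d * c * c * ‖G j‖) (hs.mul_left _)
    (fun j => by
      refine (((((tendsto_qPoch hp).comp h2).mul ((tendsto_invQPoch hp).comp ?_)).mul
        ((tendsto_invQPoch hp).comp ?_))).mul_const (G j)
      · exact tendsto_atTop_add_const_right _ j tendsto_natCast_atTop_atTop
      · exact tendsto_atTop_add_const_right _ (-j) tendsto_natCast_atTop_atTop)
    (Eventually.of_forall fun N j => by
      rw [norm_mul, norm_mul, norm_mul]
      gcongr
      exacts [hd' _, hc _, hc _])
  rw [tsum_mul_left, mul_inv_cancel₀ (tprod_one_sub_pow_ne_zero hp), one_mul] at h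
  exact h.congr fun N => (hasSum_finite_triple_product hp hp0 hu hG0 hG N).tsum_eq

/-! ### The tau function in terms of the theta function -/

lemma nome_ne_zero (ω : ℍ) : nome ω ≠ 0 := Complex.exp_ne_zero _

lemma norm_nome_sq_lt_one (ω : ℍ) : ‖nome ω ^ 2‖ < 1 := by
  rw [norm_pow]
  exact pow_lt_one₀ (norm_nonneg _) (norm_nome_lt_one ω) two_ne_zero

/-- The product `∏_{n ≥ 1} (1 - q^{2n})`. -/
def nomeProd (ω : ℍ) : ℂ := ∏' n : ℕ, (1 - nome ω ^ (2 * (n + 1)))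

lemma nomeProd_eq (ω : ℍ) : nomeProd ω = ∏' n : ℕ, (1 - (nome ω ^ 2) ^ (n + 1)) := by
  simp only [nomeProd, pow_mul]

lemma nomeProd_ne_zero (ω : ℍ) : nomeProd ω ≠ 0 := by
  rw [nomeProd_eq]
  exact tprod_one_sub_pow_ne_zero (norm_nome_sq_lt_one ω)

/-- Jacobi's two-variable theta function at the point that corresponds to `θ₁(x)`. -/
def shiftedTheta (ω : ℍ) (x : ℂ) : ℂ := jacobiTheta₂ (ω / 2 + x / π + 1 / 2) ω

lemma jacobiTheta₂_term_shifted (ω : ℍ) (x : ℂ) (j : ℤ) :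
    jacobiTheta₂_term j (ω / 2 + x / π + 1 / 2) ω =
      Complex.exp (π * Complex.I * ω * (j ^ 2 + j) + 2 * Complex.I * j * x +
        j * (π * Complex.I)) := by
  have hpi : (π : ℂ) ≠ 0 := Complex.ofReal_ne_zero.2 Real.pi_ne_zero
  rw [jacobiTheta₂_term]
  congr 1
  field_simp
  ring

lemma jacobiTheta₂_term_shifted_add_one (ω : ℍ) (x : ℂ) (j : ℤ) :
    jacobiTheta₂_term (j + 1) (ω / 2 + x / π + 1 / 2) ω =
      -Complex.exp (2 * Complex.I * x) * (nome ω ^ 2) ^ (j + 1) *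
        jacobiTheta₂_term j (ω / 2 + x / π + 1 / 2) ω := by
  have h : (nome ω ^ 2) ^ (j + 1) = Complex.exp ((j + 1) * (2 * (π * Complex.I * ω))) := by
    rw [nome, ← Complex.exp_nat_mul, ← Complex.exp_int_mul]
    push_cast
    rfl
  rw [jacobiTheta₂_term_shifted, jacobiTheta₂_term_shifted, h, neg_mul, neg_mul,
    ← neg_one_mul, ← Complex.exp_pi_mul_I, ← Complex.exp_add, ← Complex.exp_add,
    ← Complex.exp_add]
  congr 1
  push_cast
  ring

lemma hasProd_blockDet_succ (ω : ℍ) (x : ℂ) :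
    HasProd (fun n : ℕ => blockDet ω (n + 1) x) (∏' n : ℕ, blockDet ω (n + 1) x) := by
  have h := (summable_norm_blockDet_sub_one ω x).comp_injective
    (i := fun n : ℕ => (n + 1 : ℤ)) (fun a b h => by simpa using h)
  have := (multipliable_one_add_of_summable h).hasProd
  simpa only [Function.comp_apply, ← blockDet_eq_one_add] using this

lemma blockDet_neg (ω : ℍ) (n : ℤ) (x : ℂ) : blockDet ω (-n) x = blockDet ω n x := by
  simp [blockDet, coeffE]

/-- The blocks n and -n have the same determinant. -/
lemma tauFun_eq_mul_sq (ω : ℍ) (x : ℂ) :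
    tauFun ω x = blockDet ω 0 x * (∏' n : ℕ, blockDet ω (n + 1) x) ^ 2 := by
  have h1 := hasProd_blockDet_succ ω x
  have h2 : HasProd (fun n : ℕ => blockDet ω n x)
      (blockDet ω 0 x * ∏' n : ℕ, blockDet ω (n + 1) x) := by
    refine HasProd.zero_mul (f := fun n : ℕ => blockDet ω n x) ?_
    simpa using h1
  have h3 := h2.of_nat_of_neg_add_one (f := fun n : ℤ => blockDet ω n x)
    (m' := ∏' n : ℕ, blockDet ω (n + 1) x) (by simpa only [blockDet_neg] using h1)
  rw [tauFun_eq_tprod, h3.tprod_eq]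
  ring

/-- This is the triple product with p = q² and u = e^{2ix}. Its factors in u⁻¹ start at p^0, those
in u at p^1; pairing equal powers into D_n leaves 1 - u⁻¹ in front. -/
lemma shiftedTheta_eq_tprod (ω : ℍ) (x : ℂ) : (nomeProd ω)⁻¹ * shiftedTheta ω x =
    (1 - (Complex.exp (2 * Complex.I * x))⁻¹) * ∏' n : ℕ, blockDet ω (n + 1) x := by
  set u := Complex.exp (2 * Complex.I * x) with hu
  have hu0 : u ≠ 0 := Complex.exp_ne_zero _
  have hp := norm_nome_sq_lt_one ω
  have hp0 : nome ω ^ 2 ≠ 0 := pow_ne_zero _ (nome_ne_zero ω)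
  have h1 := tendsto_triple_product hp hp0 hu0
    (G := fun j => jacobiTheta₂_term j (ω / 2 + x / π + 1 / 2) ω) (by simp [jacobiTheta₂_term])
    (jacobiTheta₂_term_shifted_add_one ω x)
    (((summable_jacobiTheta₂_term_iff _ _).2 ω.im_pos).norm)
  rw [← nomeProd_eq] at h1
  -- The pairing lacks the last factor in u⁻¹, which tends to 1.
  have h2 : Tendsto (fun N : ℕ => 1 - u⁻¹ * (nome ω ^ 2) ^ N) atTop (𝓝 1) := by
    simpa using ((tendsto_pow_atTop_nhds_zero_of_norm_lt_one hp).const_mul u⁻¹).const_sub 1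
  have h3 := (hasProd_blockDet_succ ω x).tendsto_prod_nat.const_mul (1 - u⁻¹)
  have h4 := h1.mul h2
  rw [mul_one] at h4
  refine tendsto_nhds_unique h4 (h3.congr fun N => ?_)
  have hb (k : ℕ) : blockDet ω (k + 1) x =
      (1 - u * (nome ω ^ 2) ^ (k + 1)) * (1 - u⁻¹ * (nome ω ^ 2) ^ (k + 1)) := by
    have : coeffE ω (k + 1) = (nome ω ^ 2) ^ (k + 1) := by
      rw [coeffE, ← pow_mul]
      congr 1
    rw [blockDet_eq_mul, this, Complex.exp_neg, ← hu]
    ring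
  simp only [hb, Finset.prod_mul_distrib]
  have h5 := Finset.prod_range_succ (fun k => 1 - u⁻¹ * (nome ω ^ 2) ^ k) N
  rw [Finset.prod_range_succ', pow_zero, mul_one] at h5
  rw [mul_assoc _ _ (1 - u⁻¹ * (nome ω ^ 2) ^ N), ← h5]
  ring

/-- D_0 = (1 - u)(1 - u⁻¹) = -u (1 - u⁻¹)², so D_0 too is a square up to the factor -u. -/
lemma tauFun_eq_shiftedTheta (ω : ℍ) (x : ℂ) : tauFun ω x =
    -Complex.exp (2 * Complex.I * x) * shiftedTheta ω x ^ 2 / nomeProd ω ^ 2 := by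
  have h := shiftedTheta_eq_tprod ω x
  have hu0 : Complex.exp (2 * Complex.I * x) ≠ 0 := Complex.exp_ne_zero _
  have hQ := nomeProd_ne_zero ω
  have h0 : blockDet ω 0 x = (1 - Complex.exp (2 * Complex.I * x)) *
      (1 - (Complex.exp (2 * Complex.I * x))⁻¹) := by
    rw [blockDet_eq_mul, Complex.exp_neg]
    simp [coeffE]
  rw [tauFun_eq_mul_sq, h0]
  have h' : shiftedTheta ω x = nomeProd ω * ((1 - (Complex.exp (2 * Complex.I * x))⁻¹) *
      ∏' n : ℕ, blockDet ω (n + 1) x) := by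
    rw [← h, mul_inv_cancel_left₀ hQ]
  rw [h']
  field_simp
  ring

/-- The terms j = n and j = -(n+1) have the same j² + j and opposite signs; after the factor e^{ix}
they combine to a sine, and q^{1/4} completes the square to (n + 1/2)². -/
lemma theta1_eq_shiftedTheta (ω : ℍ) (x : ℂ) : theta1 ω x =
    -Complex.I * Complex.exp (π * Complex.I * ω / 4) * Complex.exp (Complex.I * x) *
      shiftedTheta ω x := by
  have h := (hasSum_jacobiTheta₂_term (ω / 2 + x / π + 1 / 2) ω.im_pos).nat_add_neg_add_one
  have h2 := h.mul_left
    (-Complex.I * Complex.exp (π * Complex.I * ω / 4) * Complex.exp (Complex.I * x))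
  rw [theta1, ← tsum_mul_left, shiftedTheta, ← h2.tsum_eq]
  refine tsum_congr fun n => ?_
  have hn : ((-1 : ℂ)) ^ n = Complex.exp (n * (π * Complex.I)) := by
    rw [Complex.exp_nat_mul, Complex.exp_pi_mul_I]
  have hn' : Complex.exp ((-(n + 1 : ℤ) : ℤ) * (π * Complex.I)) =
      -Complex.exp (n * (π * Complex.I)) := by
    rw [Complex.exp_int_mul, Complex.exp_pi_mul_I, zpow_neg, zpow_add_one₀ (by norm_num),
      zpow_natCast, ← hn]
    rcases neg_one_pow_eq_or ℂ n with h | h <;> rw [h] <;> norm_num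
  rw [jacobiTheta₂_term_shifted, jacobiTheta₂_term_shifted, Complex.exp_add _ (_ * (π * Complex.I)),
    Complex.exp_add _ (_ * (π * Complex.I)), hn', hn, Complex.sin]
  have e1 : Complex.exp (π * Complex.I * ω / 4) * Complex.exp (Complex.I * x) *
      Complex.exp (π * Complex.I * ω * (((n : ℤ) : ℂ) ^ 2 + (n : ℤ)) +
        2 * Complex.I * (n : ℤ) * x) =
      Complex.exp (π * Complex.I * ω * ((n : ℂ) + 1 / 2) ^ 2) *
        Complex.exp ((2 * n + 1) * x * Complex.I) := by
    simp only [← Complex.exp_add]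
    congr 1
    push_cast
    ring
  have e2 : Complex.exp (π * Complex.I * ω / 4) * Complex.exp (Complex.I * x) *
      Complex.exp (π * Complex.I * ω * ((((-(n + 1 : ℤ)) : ℤ) : ℂ) ^ 2 + (-(n + 1 : ℤ) : ℤ)) +
        2 * Complex.I * (-(n + 1 : ℤ) : ℤ) * x) =
      Complex.exp (π * Complex.I * ω * ((n : ℂ) + 1 / 2) ^ 2) *
        Complex.exp (-((2 * n + 1) * x) * Complex.I) := by
    simp only [← Complex.exp_add]
    congr 1
    push_cast
    ring
  simp only [Int.cast_natCast] at e1 ⊢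
  linear_combination (Complex.I * Complex.exp (n * (π * Complex.I))) * (e1 - e2)

lemma tauFun_eq_theta1 (ω : ℍ) (x : ℂ) : tauFun ω x = theta1 ω x ^ 2 /
    (Complex.exp (π * Complex.I * ω / 2) * nomeProd ω ^ 2) := by
  have hQ := nomeProd_ne_zero ω
  have h1 : Complex.exp (π * Complex.I * ω / 2) = Complex.exp (π * Complex.I * ω / 4) ^ 2 := by
    rw [← Complex.exp_nat_mul]
    push_cast
    ring_nf
  have h2 : Complex.exp (2 * Complex.I * x) = Complex.exp (Complex.I * x) ^ 2 := by
    rw [← Complex.exp_nat_mul]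
    push_cast
    ring_nf
  have h3 : Complex.exp (π * Complex.I * ω / 4) ≠ 0 := Complex.exp_ne_zero _
  rw [tauFun_eq_shiftedTheta, theta1_eq_shiftedTheta, h1, h2]
  field_simp
  rw [Complex.I_sq]
  ring

/-! ### Analytic properties of the tau function -/

/-- The injective reindexing lets one estimate serve both the product over all n and the product
over n ≥ 1. -/
lemma hasProdLocallyUniformlyOn_blockDet (ω : ℍ) {ι : Type*} {i : ι → ℤ}
    (hi : Function.Injective i) :
    HasProdLocallyUniformlyOn (fun n x => blockDet ω (i n) x)
      (fun x => ∏' n, blockDet ω (i n) x) Set.univ := by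
  refine hasProdLocallyUniformlyOn_of_forall_compact isOpen_univ fun K _ hK => ?_
  simp only [blockDet_eq_one_add]
  obtain ⟨M, hM⟩ := hK.exists_bound_of_continuousOn (f := fun x : ℂ => Complex.cos (2 * x))
    (by fun_prop)
  refine Summable.hasProdUniformlyOn_one_add hK
    (((summable_norm_coeffE ω).comp_injective hi).mul_right (2 * M + 1))
    (Eventually.of_forall fun n x hx => ?_) (fun n => by fun_prop)
  refine (norm_add_le _ _).trans ?_
  have h1 := norm_coeffE_le_one ω (i n)
  have h2 : ‖coeffE ω (i n)‖ ^ 2 ≤ ‖coeffE ω (i n)‖ := by nlinarith [norm_nonneg (coeffE ω (i n))]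
  have h3 : ‖coeffE ω (i n)‖ * ‖Complex.cos (2 * x)‖ ≤ ‖coeffE ω (i n)‖ * M := by
    gcongr
    exact hM x hx
  simp only [norm_neg, norm_mul, norm_pow, Complex.norm_ofNat, Function.comp_apply]
  linarith

lemma hasDerivAt_blockDet (ω : ℍ) (n : ℤ) (x : ℂ) :
    HasDerivAt (blockDet ω n) (4 * Complex.sin (2 * x) * coeffE ω n) x := by
  have h0 : HasDerivAt (fun z : ℂ => 2 * z) 2 x := by
    simpa using (hasDerivAt_id x).const_mul 2
  refine (((h0.ccos.const_mul (2 * coeffE ω n)).const_sub 1).add_const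
    (coeffE ω n ^ 2)).congr_deriv ?_
  ring

lemma differentiable_blockDet (ω : ℍ) (n : ℤ) : Differentiable ℂ (blockDet ω n) :=
  fun x => (hasDerivAt_blockDet ω n x).differentiableAt

lemma differentiable_tprod_blockDet (ω : ℍ) {ι : Type*} {i : ι → ℤ}
    (hi : Function.Injective i) : Differentiable ℂ fun x => ∏' n, blockDet ω (i n) x := by
  refine differentiableOn_univ.1 ?_
  refine TendstoLocallyUniformlyOn.differentiableOn
    (hasProdLocallyUniformlyOn_blockDet ω hi) (Eventually.of_forall fun s => ?_) isOpen_univ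
  have (n : ι) := (differentiable_blockDet ω (i n)).differentiableOn (s := Set.univ)
  fun_prop

lemma tauFun_eq_tprod_fun (ω : ℍ) : tauFun ω = fun x => ∏' n, blockDet ω n x :=
  funext (tauFun_eq_tprod ω)

lemma differentiable_tauFun (ω : ℍ) : Differentiable ℂ (tauFun ω) := by
  rw [tauFun_eq_tprod_fun]
  exact differentiable_tprod_blockDet ω Function.injective_id

/-- Since D_n' = 4 c_n sin 2x with c_n = q^{2|n|}, termwise logarithmic differentiation yields
exactly the trace series of `hasTrace_kernel`. -/
lemma logDeriv_tauFun (ω : ℍ) {x : ℂ} (hx : x ∉ (periods ω).lattice) :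
    logDeriv (tauFun ω) x =
      ∑' n, 4 * Complex.sin (2 * x) * (coeffE ω n * (blockDet ω n x)⁻¹) := by
  have hl (n : ℤ) : logDeriv (blockDet ω n) x =
      4 * Complex.sin (2 * x) * (coeffE ω n * (blockDet ω n x)⁻¹) := by
    rw [logDeriv_apply, (hasDerivAt_blockDet ω n x).deriv]
    ring
  have h0 := tauFun_ne_zero ω hx
  rw [tauFun_eq_tprod] at h0
  rw [tauFun_eq_tprod_fun, logDeriv_tprod_eq_tsum isOpen_univ (Set.mem_univ x)
    (blockDet_ne_zero ω hx) (fun n => (differentiable_blockDet ω n).differentiableOn) ?_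
    (hasProdLocallyUniformlyOn_blockDet ω
      Function.injective_id).multipliableLocallyUniformlyOn h0]
  · exact tsum_congr hl
  · simp only [hl]
    exact (summable_norm_coeffE_mul_inv_blockDet ω x).of_norm.mul_left _

lemma hasTrace_kernel_logDeriv (ω : ℍ) {x : ℂ} (hx : x ∉ (periods ω).lattice) :
    HasTrace (W ω x x) (logDeriv (tauFun ω) x) := by
  rw [logDeriv_tauFun ω hx]
  exact hasTrace_kernel ω hx

/-! ### Behaviour under the periods π and πω -/

lemma tauFun_add_pi (ω : ℍ) (x : ℂ) : tauFun ω (x + π) = tauFun ω x := by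
  rw [tauFun_eq_tprod, tauFun_eq_tprod]
  refine tprod_congr fun n => ?_
  rw [blockDet, blockDet, mul_add, Complex.cos_add_two_pi]

lemma tauFun_add_pi_mul (ω : ℍ) (x : ℂ) : tauFun ω (x + π * ω) =
    Complex.exp (-2 * π * Complex.I * ω - 4 * Complex.I * x) * tauFun ω x := by
  have hpi : (π : ℂ) ≠ 0 := Complex.ofReal_ne_zero.2 Real.pi_ne_zero
  have hv : (ω : ℂ) / 2 + (x + π * ω) / π + 1 / 2 = (ω / 2 + x / π + 1 / 2) + ω := by
    field_simp
    ring
  rw [tauFun_eq_shiftedTheta, tauFun_eq_shiftedTheta, shiftedTheta, shiftedTheta, hv,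
    jacobiTheta₂_add_left', mul_pow, ← Complex.exp_nat_mul]
  have h : Complex.exp (2 * Complex.I * (x + π * ω)) *
      Complex.exp ((2 : ℕ) * (-π * Complex.I * (ω + 2 * (ω / 2 + x / π + 1 / 2)))) =
      Complex.exp (-2 * π * Complex.I * ω - 4 * Complex.I * x) *
        Complex.exp (2 * Complex.I * x) := by
    rw [← Complex.exp_add, ← Complex.exp_add, Complex.exp_eq_exp_iff_exists_int]
    -- The summand 1/2 in the theta argument contributes -2πi to the exponent.
    refine ⟨-1, ?_⟩
    push_cast
    field_simp
    ring
  linear_combination (-jacobiTheta₂ (ω / 2 + x / π + 1 / 2) ω ^ 2 / nomeProd ω ^ 2) * h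

lemma logDeriv_tauFun_add_pi (ω : ℍ) (x : ℂ) :
    logDeriv (tauFun ω) (x + π) = logDeriv (tauFun ω) x := by
  have h : (fun z => tauFun ω (z + π)) = tauFun ω := funext (tauFun_add_pi ω)
  rw [logDeriv_apply, logDeriv_apply, tauFun_add_pi, ← deriv_comp_add_const, h]

lemma logDeriv_tauFun_add_pi_mul (ω : ℍ) {x : ℂ} (hx : x ∉ (periods ω).lattice) :
    logDeriv (tauFun ω) (x + π * ω) = logDeriv (tauFun ω) x - 4 * Complex.I := by
  have h : (fun z => tauFun ω (z + π * ω)) = fun z =>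
      Complex.exp (-2 * π * Complex.I * ω - 4 * Complex.I * z) * tauFun ω z :=
    funext (tauFun_add_pi_mul ω)
  have h1 : HasDerivAt (fun z : ℂ => -2 * π * Complex.I * ω - 4 * Complex.I * z)
      (-(4 * Complex.I)) x := by
    simpa using ((hasDerivAt_id x).const_mul (4 * Complex.I)).const_sub (-2 * π * Complex.I * ω)
  have h2 := h1.cexp.mul (differentiable_tauFun ω x).hasDerivAt
  have h3 := (congrArg (deriv · x) h).trans h2.deriv
  beta_reduce at h3
  rw [deriv_comp_add_const] at h3
  have h0 := tauFun_ne_zero ω hx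
  have he := Complex.exp_ne_zero (-2 * π * Complex.I * ω - 4 * Complex.I * x)
  rw [logDeriv_apply, logDeriv_apply, tauFun_add_pi_mul, h3]
  field_simp
  ring

lemma lattice_isOpen_compl (ω : ℍ) : IsOpen {x : ℂ | x ∉ (periods ω).lattice} :=
  (periods ω).isClosed_lattice.isOpen_compl

lemma eventually_notMem_lattice (ω : ℍ) {x : ℂ} (hx : x ∉ (periods ω).lattice) :
    ∀ᶠ z in 𝓝 x, z ∉ (periods ω).lattice := (lattice_isOpen_compl ω).mem_nhds hx

lemma eventually_notMem_lattice_nhdsNE (ω : ℍ) (x : ℂ) :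
    ∀ᶠ z in 𝓝[≠] x, z ∉ (periods ω).lattice := by
  filter_upwards [nhdsWithin_le_nhds ((periods ω).compl_lattice_sdiff_singleton_mem_nhds x),
    self_mem_nhdsWithin] with z hz hzx h
  exact hz ⟨h, hzx⟩

lemma pi_mem_lattice (ω : ℍ) : (π : ℂ) ∈ (periods ω).lattice := (periods ω).ω₁_mem_lattice

lemma pi_mul_mem_lattice (ω : ℍ) : (π * ω : ℂ) ∈ (periods ω).lattice :=
  (periods ω).ω₂_mem_lattice

lemma d2LogTau_add_pi (ω : ℍ) (x : ℂ) : d2LogTau ω (x + π) = d2LogTau ω x := by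
  have h : (fun z => logDeriv (tauFun ω) (z + π)) = logDeriv (tauFun ω) :=
    funext (logDeriv_tauFun_add_pi ω)
  rw [d2LogTau, d2LogTau, ← deriv_comp_add_const, h]

/-- The logarithmic derivative changes by the constant -4i, which a further derivative removes. -/
lemma d2LogTau_add_pi_mul (ω : ℍ) {x : ℂ} (hx : x ∉ (periods ω).lattice) :
    d2LogTau ω (x + π * ω) = d2LogTau ω x := by
  have h : (fun z => logDeriv (tauFun ω) (z + π * ω)) =ᶠ[𝓝 x]
      fun z => logDeriv (tauFun ω) z - 4 * Complex.I := by
    filter_upwards [eventually_notMem_lattice ω hx] with z hz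
    exact logDeriv_tauFun_add_pi_mul ω hz
  rw [d2LogTau, d2LogTau, ← deriv_comp_add_const, h.deriv_eq, deriv_sub_const]

lemma add_mem_lattice_iff (ω : ℍ) (x : ℂ) {l : ℂ} (hl : l ∈ (periods ω).lattice) :
    x + l ∈ (periods ω).lattice ↔ x ∈ (periods ω).lattice :=
  (periods ω).lattice.add_mem_iff_left hl

lemma periodic_of_periods {α : Type*} (ω : ℍ) {f : ℂ → α} (h1 : f.Periodic π)
    (h2 : f.Periodic (π * ω)) {l : ℂ} (hl : l ∈ (periods ω).lattice) : f.Periodic l := by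
  obtain ⟨m, n, rfl⟩ := PeriodPair.mem_lattice.1 hl
  exact (h1.int_mul m).add_period (h2.int_mul n)

lemma d2LogTau_add_mem_lattice (ω : ℍ) {x l : ℂ} (hx : x ∉ (periods ω).lattice)
    (hl : l ∈ (periods ω).lattice) : d2LogTau ω (x + l) = d2LogTau ω x := by
  classical
  -- Replacing the values on the lattice by 0 gives a function periodic at every point, so
  -- periodicity passes from the two generators to the whole lattice.
  have key : (fun z => if z ∈ (periods ω).lattice then 0 else d2LogTau ω z).Periodic l := by
    refine periodic_of_periods ω (fun z => ?_) (fun z => ?_) hl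
    · simp only [add_mem_lattice_iff ω z (pi_mem_lattice ω), d2LogTau_add_pi]
    · simp only [add_mem_lattice_iff ω z (pi_mul_mem_lattice ω)]
      split_ifs with h
      · rfl
      · exact d2LogTau_add_pi_mul ω h
  have := key x
  simpa only [add_mem_lattice_iff ω x hl, if_neg hx] using this

lemma analyticAt_tauFun (ω : ℍ) (x : ℂ) : AnalyticAt ℂ (tauFun ω) x :=
  (differentiable_tauFun ω).analyticAt x

lemma analyticAt_logDeriv_tauFun (ω : ℍ) {x : ℂ} (hx : x ∉ (periods ω).lattice) :
    AnalyticAt ℂ (logDeriv (tauFun ω)) x :=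
  (analyticAt_tauFun ω x).deriv.div (analyticAt_tauFun ω x) (tauFun_ne_zero ω hx)

lemma analyticAt_d2LogTau (ω : ℍ) {x : ℂ} (hx : x ∉ (periods ω).lattice) :
    AnalyticAt ℂ (d2LogTau ω) x :=
  (analyticAt_logDeriv_tauFun ω hx).deriv

/-! ### The tau function near the origin -/

/-- The entire function `τ(x) / x²`. -/
def tauQuot (ω : ℍ) (x : ℂ) : ℂ :=
  4 * dslope Complex.sin 0 x ^ 2 * (∏' n : ℕ, blockDet ω (n + 1) x) ^ 2

/-- D_0 = 2 - 2 cos 2x = 4 sin² x supplies the double zero. -/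
lemma tauFun_eq_sq_mul (ω : ℍ) (x : ℂ) : tauFun ω x = x ^ 2 * tauQuot ω x := by
  have hs := sub_smul_dslope Complex.sin 0 x
  rw [sub_zero, smul_eq_mul, Complex.sin_zero, sub_zero] at hs
  have h0 : blockDet ω 0 x = 4 * Complex.sin x ^ 2 := by
    have : coeffE ω 0 = 1 := by simp [coeffE]
    rw [blockDet, this, Complex.cos_two_mul]
    linear_combination (-4) * Complex.sin_sq_add_cos_sq x
  rw [tauFun_eq_mul_sq, tauQuot, h0, ← hs]
  ring

lemma differentiable_tauQuot (ω : ℍ) : Differentiable ℂ (tauQuot ω) := by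
  have h1 : Differentiable ℂ (dslope Complex.sin 0) := by
    refine differentiableOn_univ.1 ((Complex.differentiableOn_dslope univ_mem).2 ?_)
    exact Complex.differentiable_sin.differentiableOn
  have h2 : Differentiable ℂ fun x => ∏' n : ℕ, blockDet ω (n + 1) x :=
    differentiable_tprod_blockDet ω (i := fun n : ℕ => (n + 1 : ℤ))
      (fun a b h => by simpa using h)
  exact ((h1.pow 2).const_mul 4).mul (h2.pow 2)

lemma tauQuot_zero_ne_zero (ω : ℍ) : tauQuot ω 0 ≠ 0 := by
  have h : ∏' n : ℕ, blockDet ω (n + 1) 0 ≠ 0 := by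
    have hs := (summable_norm_blockDet_sub_one ω 0).comp_injective
      (i := fun n : ℕ => (n + 1 : ℤ)) (fun a b h => by simpa using h)
    simp only [blockDet_eq_one_add]
    refine tprod_one_add_ne_zero_of_summable (fun n => ?_) hs
    rw [← blockDet_eq_one_add]
    have hc : coeffE ω (n + 1) = (nome ω ^ 2) ^ (n + 1) := by
      rw [coeffE, ← pow_mul]
      congr 1
    have h1 := one_sub_pow_succ_ne_zero (norm_nome_sq_lt_one ω) n
    rw [blockDet_eq_mul, hc]
    simpa using h1
  rw [tauQuot, dslope_same, Complex.deriv_sin, Complex.cos_zero]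
  simpa using h

lemma d2LogTau_eq_near_zero (ω : ℍ) :
    ∀ᶠ x in 𝓝[≠] 0, d2LogTau ω x = deriv (logDeriv (tauQuot ω)) x - 2 / x ^ 2 := by
  have hg : ∀ᶠ x in 𝓝 0, tauQuot ω x ≠ 0 :=
    (differentiable_tauQuot ω).continuous.continuousAt.eventually_ne (tauQuot_zero_ne_zero ω)
  filter_upwards [nhdsWithin_le_nhds hg, self_mem_nhdsWithin] with x hgx hx
  have hx : x ≠ 0 := hx
  have hev : logDeriv (tauFun ω) =ᶠ[𝓝 x] fun z => 2 * z⁻¹ + logDeriv (tauQuot ω) z := by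
    filter_upwards [(differentiable_tauQuot ω).continuous.continuousAt.eventually_ne hgx,
      eventually_ne_nhds hx] with z hgz hz
    have hf : tauFun ω = fun z => z ^ 2 * tauQuot ω z := funext (tauFun_eq_sq_mul ω)
    rw [hf, logDeriv_mul (f := fun z : ℂ => z ^ 2) z (pow_ne_zero 2 hz) hgz (by fun_prop)
      (differentiable_tauQuot ω z)]
    congr 1
    rw [logDeriv_apply, deriv_pow_field]
    field_simp
    simp
    ring
  have ha : AnalyticAt ℂ (tauQuot ω) x := (differentiable_tauQuot ω).analyticAt x
  have hd := (ha.deriv.div ha hgx).differentiableAt.hasDerivAt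
  have h2 := ((hasDerivAt_inv hx).const_mul 2).add hd
  rw [d2LogTau, hev.deriv_eq]
  refine h2.deriv.trans ?_
  change _ + deriv (logDeriv (tauQuot ω)) x = _
  ring

/-! ### The elliptic potential -/

/-- Near 0 the pole 2/z² of 2℘ cancels the -2/z² of (log τ)''. By periodicity all poles cancel, and
Liouville's theorem applies to the extended function. -/
lemma two_mul_weierstrassP_add_d2LogTau (ω : ℍ) {x y : ℂ} (hx : x ∉ (periods ω).lattice)
    (hy : y ∉ (periods ω).lattice) :
    2 * ℘[periods ω] x + d2LogTau ω x = 2 * ℘[periods ω] y + d2LogTau ω y := by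
  classical
  set h : ℂ → ℂ := fun z => 2 * (periods ω).weierstrassPExcept 0 z +
    deriv (logDeriv (tauQuot ω)) z with hh
  have hh0 : AnalyticAt ℂ h 0 := by
    have h1 := (periods ω).analyticAt_weierstrassPExcept 0
    have h2 : AnalyticAt ℂ (tauQuot ω) 0 := (differentiable_tauQuot ω).analyticAt 0
    exact (analyticAt_const.mul h1).add (h2.deriv.div h2 (tauQuot_zero_ne_zero ω)).deriv
  -- `h` is the sum with both polar parts removed; its value at 0 fills in every lattice point at
  -- once.
  set F : ℂ → ℂ := fun z => if z ∈ (periods ω).lattice then h 0 else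
    2 * ℘[periods ω] z + d2LogTau ω z with hF
  have hper (z w : ℂ) (hw : w ∈ (periods ω).lattice) : F (z + w) = F z := by
    simp only [hF, add_mem_lattice_iff ω z hw]
    split_ifs with hz
    · rfl
    · rw [d2LogTau_add_mem_lattice ω hz hw, (periods ω).weierstrassP_add_coe z ⟨w, hw⟩]
  have hF0 : F =ᶠ[𝓝 0] h := by
    have h1 : ∀ᶠ z in 𝓝[≠] (0 : ℂ), F z = h z := by
      filter_upwards [eventually_notMem_lattice_nhdsNE ω 0, d2LogTau_eq_near_zero ω] with z hz hd
      have hP := (periods ω).weierstrassPExcept_add 0 z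
      simp only [hF, if_neg hz, hh, hd, ← hP]
      simp
      ring
    have h0 : F 0 = h 0 := by simp [hF]
    filter_upwards [eventually_nhdsWithin_iff.1 h1] with z hz
    rcases eq_or_ne z 0 with rfl | hz0
    exacts [h0, hz hz0]
  have hd : Differentiable ℂ F := by
    intro z
    by_cases hz : z ∈ (periods ω).lattice
    -- Differentiability at 0 is transported to the lattice point `z` by translation.
    · have h1 : DifferentiableAt ℂ F (z - z) := by
        rw [sub_self]
        exact (hh0.congr hF0.symm).differentiableAt
      have h2 := h1.comp z (f := fun w => w - z) (by fun_prop)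
      have h3 : F ∘ (fun w => w - z) = F := by
        funext w
        have := hper (w - z) z hz
        rw [sub_add_cancel] at this
        exact this.symm
      rwa [h3] at h2
    · have h1 : F =ᶠ[𝓝 z] fun w => 2 * ℘[periods ω] w + d2LogTau ω w := by
        filter_upwards [eventually_notMem_lattice ω hz] with w hw
        simp [hF, hw]
      have h2 := (periods ω).analyticOnNhd_weierstrassP z hz
      exact (((analyticAt_const.mul h2).add (analyticAt_d2LogTau ω hz)).congr
        h1.symm).differentiableAt
  have hb := (IsZLattice.isCompact_range_of_periodic (periods ω).lattice F hd.continuous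
    hper).isBounded
  have := hd.apply_eq_apply_of_bounded hb x y
  simpa [hF, hx, hy] using this

/-! ### Real points -/

lemma notMem_lattice_of_real (ω : ℍ) {y : ℝ} (h0 : 0 < y) (h1 : y < 2 * π) (h2 : y ≠ π) :
    (y : ℂ) ∉ (periods ω).lattice := by
  intro h
  obtain ⟨m, n, hmn⟩ := PeriodPair.mem_lattice.1 h
  have him := congrArg Complex.im hmn
  have hre := congrArg Complex.re hmn
  have hn : (n : ℝ) = 0 := by
    have : (n : ℝ) * (π * ω.im) = 0 := by simpa [periods] using him
    exact (mul_eq_zero.1 this).resolve_right (mul_pos Real.pi_pos ω.im_pos).ne'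
  have hn' : n = 0 := by exact_mod_cast hn
  subst hn'
  have hm : (m : ℝ) * π = y := by simpa [periods] using hre
  have h3 : (0 : ℝ) < m := pos_of_mul_pos_left (hm ▸ h0) Real.pi_pos.le
  have h4 : (m : ℝ) < 2 := lt_of_mul_lt_mul_right (hm ▸ h1) Real.pi_pos.le
  have h5 : m = 1 := by
    have h3' : 0 < m := by exact_mod_cast h3
    have h4' : m < 2 := by exact_mod_cast h4
    omega
  subst h5
  exact h2 (by simpa using hm.symm)

lemma notMem_lattice_of_mem_Ioo (ω : ℍ) {y : ℝ} (hy : y ∈ Set.Ioo 0 π) :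
    (y : ℂ) ∉ (periods ω).lattice :=
  notMem_lattice_of_real ω hy.1 (by linarith [hy.2, Real.pi_pos]) hy.2.ne

lemma tauFun_eq_mul_exp_integral (ω : ℍ) {a x : ℝ} (ha : a ∈ Set.Ioo 0 π)
    (hx : x ∈ Set.Ioo 0 π) :
    IntervalIntegrable (fun y : ℝ => trace (W ω y y)) MeasureTheory.volume a x ∧
      tauFun ω x = tauFun ω a * Complex.exp (∫ y : ℝ in a..x, trace (W ω y y)) := by
  set L : ℝ → ℂ := fun y => logDeriv (tauFun ω) y with hL
  have htr {y : ℝ} (hy : y ∈ Set.Ioo 0 π) : trace (W ω y y) = L y :=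
    (hasTrace_kernel_logDeriv ω (notMem_lattice_of_mem_Ioo ω hy)).2.tsum_eq
  have hLc {y : ℝ} (hy : y ∈ Set.Ioo 0 π) : ContinuousAt L y :=
    (analyticAt_logDeriv_tauFun ω (notMem_lattice_of_mem_Ioo ω hy)).continuousAt.comp
      Complex.continuous_ofReal.continuousAt
  have hsub {y : ℝ} (hy : y ∈ Set.Ioo 0 π) : Set.uIcc a y ⊆ Set.Ioo 0 π :=
    Set.ordConnected_Ioo.uIcc_subset ha hy
  have hcont : ContinuousOn L (Set.Ioo 0 π) := fun y hy => (hLc hy).continuousWithinAt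
  have hint {y : ℝ} (hy : y ∈ Set.Ioo 0 π) : IntervalIntegrable L MeasureTheory.volume a y :=
    (hcont.mono (hsub hy)).intervalIntegrable
  have heq : Set.EqOn (fun y : ℝ => trace (W ω y y)) L (Set.uIcc a x) :=
    fun y hy => htr (hsub hx hy)
  refine ⟨(hint hx).congr (heq.symm.mono Set.uIoc_subset_uIcc), ?_⟩
  rw [intervalIntegral.integral_congr heq]
  -- Dividing τ by the proposed exponential avoids any logarithm of τ.
  have hd {y : ℝ} (hy : y ∈ Set.Ioo 0 π) : HasDerivAt
      (fun y : ℝ => tauFun ω y * Complex.exp (-∫ t in a..y, L t)) 0 y := by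
    have h1 := (differentiable_tauFun ω y).hasDerivAt.comp_ofReal
    have h2 := intervalIntegral.integral_hasDerivAt_right (hint hy)
      (hcont.stronglyMeasurableAtFilter isOpen_Ioo y hy) (hLc hy)
    refine (h1.mul h2.neg.cexp).congr_deriv ?_
    have h0 := tauFun_ne_zero ω (notMem_lattice_of_mem_Ioo ω hy)
    simp only [hL, logDeriv_apply]
    field_simp
    ring
  have h := isOpen_Ioo.is_const_of_deriv_eq_zero isPreconnected_Ioo
    (fun y hy => (hd hy).differentiableAt.differentiableWithinAt) (fun y hy => (hd hy).deriv) hx ha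
  simp only [intervalIntegral.integral_same, neg_zero, Complex.exp_zero, mul_one] at h
  rw [← h, mul_assoc, ← Complex.exp_add, neg_add_cancel, Complex.exp_zero, mul_one]

/-! ### The Liouvillian extension -/

lemma eventually_codiscrete_iff {P : ℂ → Prop} :
    (∀ᶠ z in codiscrete ℂ, P z) ↔ ∀ x, ∀ᶠ z in 𝓝[≠] x, P z := by
  change {z | P z} ∈ codiscrete ℂ ↔ _
  rw [mem_codiscrete]
  simp only [disjoint_principal_right, compl_compl]
  rfl

lemma tendsto_add_const_codiscrete (l : ℂ) :
    Tendsto (fun z => z + l) (codiscrete ℂ) (codiscrete ℂ) := by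
  intro s hs
  refine eventually_codiscrete_iff.2 fun x => ?_
  have ht : Tendsto (fun z : ℂ => z + l) (𝓝[≠] x) (𝓝[≠] (x + l)) := by
    refine tendsto_nhdsWithin_iff.2 ⟨?_, ?_⟩
    · exact ((continuous_add_const l).tendsto x).mono_left nhdsWithin_le_nhds
    · filter_upwards [self_mem_nhdsWithin] with z hz
      simpa using hz
  exact ht (eventually_codiscrete_iff.1 hs (x + l))

lemma deriv_congr_codiscrete {f g : ℂ → ℂ} (h : f =ᶠ[codiscrete ℂ] g) :
    deriv f =ᶠ[codiscrete ℂ] deriv g :=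
  eventually_codiscrete_iff.2 fun x =>
    EventuallyEq.nhdsNE_deriv (eventually_codiscrete_iff.1 h x)

lemma isDifferentialField_ellipticField (L : PeriodPair) :
    IsDifferentialField (ellipticField L) where
  meromorphic f hf := hf.1
  congr f hf g hg := by
    refine ⟨hf.1.congr_codiscrete hg.symm, fun l hl => ?_⟩
    exact ((hg.comp_tendsto (tendsto_add_const_codiscrete l)).trans (hf.2 l hl)).trans hg.symm
  const_mem c := ⟨Meromorphic.const c, fun l _ => EventuallyEq.rfl⟩
  add_mem f hf g hg := ⟨hf.1.add hg.1, fun l hl => (hf.2 l hl).add (hg.2 l hl)⟩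
  mul_mem f hf g hg := ⟨hf.1.mul hg.1, fun l hl => (hf.2 l hl).mul (hg.2 l hl)⟩
  inv_mem f hf := ⟨hf.1.inv, fun l hl => (hf.2 l hl).inv⟩
  deriv_mem f hf := by
    refine ⟨hf.1.deriv, fun l hl => ?_⟩
    have h := deriv_congr_codiscrete (hf.2 l hl)
    have h1 : deriv (fun z => f (z + l)) = fun z => deriv f (z + l) :=
      funext fun z => deriv_comp_add_const _ _ _
    rwa [h1] at h

lemma mem_adjoin_self (K : Set (ℂ → ℂ)) (h : ℂ → ℂ) : h ∈ adjoin K h :=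
  Set.mem_sInter.2 fun _ hL => hL.2.2

lemma eventually_codiscrete_notMem_lattice (ω : ℍ) :
    ∀ᶠ z in codiscrete ℂ, z ∉ (periods ω).lattice :=
  eventually_codiscrete_iff.2 (eventually_notMem_lattice_nhdsNE ω)

lemma meromorphic_tauFun (ω : ℍ) : Meromorphic (tauFun ω) :=
  fun x => (analyticAt_tauFun ω x).meromorphicAt

lemma d2LogTau_mem_ellipticField (ω : ℍ) : d2LogTau ω ∈ ellipticField (periods ω) := by
  refine ⟨(meromorphic_tauFun ω).logDeriv.deriv, fun l hl => ?_⟩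
  filter_upwards [eventually_codiscrete_notMem_lattice ω] with z hz
  exact d2LogTau_add_mem_lattice ω hz hl

/-- Two adjunctions suffice: τ'/τ as an integral of the elliptic function (log τ)'', then τ as a
nonzero solution of h' = (τ'/τ) h. -/
lemma exists_isLiouvillianExtension (ω : ℍ) :
    ∃ L : Set (ℂ → ℂ), IsLiouvillianExtension (ellipticField (periods ω)) L ∧ tauFun ω ∈ L := by
  refine ⟨_, ((IsLiouvillianExtension.refl (isDifferentialField_ellipticField _)).step
    (h := logDeriv (tauFun ω)) ⟨(meromorphic_tauFun ω).logDeriv, Or.inl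
      ⟨_, d2LogTau_mem_ellipticField ω, EventuallyEq.rfl⟩⟩).step
    (h := tauFun ω) ⟨meromorphic_tauFun ω, Or.inr (Or.inl ⟨fun h => ?_, logDeriv (tauFun ω),
      mem_adjoin_self _ _, ?_⟩)⟩, mem_adjoin_self _ _⟩
  · have h1 := eventually_codiscrete_iff.1 (h.and (eventually_codiscrete_notMem_lattice ω)) 0
    obtain ⟨z, hz, hzL⟩ := h1.exists
    exact tauFun_ne_zero ω hzL hz
  · filter_upwards [eventually_codiscrete_notMem_lattice ω] with z hz
    rw [Pi.mul_apply, logDeriv_apply, div_mul_cancel₀ _ (tauFun_ne_zero ω hz)]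

end PeriodicSystem

end
open PeriodicSystem in
theorem proposition11p2 (ω : ℍ) :
    IsPeriodicLinearSystem opA (opB ω) opC (opE ω) 1 ∧
    -- the Gelfand-Levitan equation
    (∀ x y : ℝ, 0 < x → x < y → y < 2 * π → x ≠ π →
      IsUnit (1 - opT ω x) ∧
      IntervalIntegrable (fun z : ℝ => W ω x z * phi ω (z + y)) MeasureTheory.volume x (2 * π) ∧
      -phi ω (x + y) + W ω x y - (∫ z : ℝ in x..2 * π, W ω x z * phi ω (z + y))
        = W ω x y * opE ω) ∧
    -- the trace of the scattering function
    (∀ x : ℂ, HasTrace (phi ω x)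
      (4 * ((1 + nome ω ^ 2) / (1 - nome ω ^ 2)) * Complex.sin x)) ∧
    -- the tau function as a Fredholm determinant, and its relation to the trace of `W`
    (∀ x : ℂ, HasFredholmDet (opT ω x) (tauFun ω x)) ∧
    (∀ x : ℂ, x ∉ (periods ω).lattice →
      IsUnit (1 - opT ω x) ∧ tauFun ω x ≠ 0 ∧ HasTrace (W ω x x) (logDeriv (tauFun ω) x)) ∧
    (∀ a ∈ Set.Ioo 0 π, ∀ x ∈ Set.Ioo 0 π,
      IntervalIntegrable (fun y : ℝ => trace (W ω y y)) MeasureTheory.volume a x ∧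
      tauFun ω x = tauFun ω a * Complex.exp (∫ y : ℝ in a..x, trace (W ω y y))) ∧
    -- the tau function and the theta function
    (∀ x : ℂ, tauFun ω x = theta1 ω x ^ 2 /
      (Complex.exp (π * Complex.I * ω / 2) * (∏' n : ℕ, (1 - nome ω ^ (2 * (n + 1)))) ^ 2)) ∧
    Differentiable ℂ (tauFun ω) ∧
    (∃ L : Set (ℂ → ℂ), IsLiouvillianExtension (ellipticField (periods ω)) L ∧
      tauFun ω ∈ L) ∧
    -- the elliptic potential
    (∀ x : ℂ, x ∉ (periods ω).lattice →
      2 * ℘[periods ω] x = -d2LogTau ω x + (2 * ℘[periods ω] (π / 2) + d2LogTau ω (π / 2))) := by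
  have hpi : (π / 2 : ℂ) ∉ (periods ω).lattice := by
    have := notMem_lattice_of_mem_Ioo ω (y := π / 2) ⟨Real.pi_div_two_pos, by
      linarith [Real.pi_pos]⟩
    simpa using this
  refine ⟨isPeriodicLinearSystem ω, fun x y h0 hxy hy hx => ?_, hasTrace_phi ω,
    hasFredholmDet_opT ω, fun x hx => ⟨isUnit_one_sub_opT ω hx, tauFun_ne_zero ω hx,
      hasTrace_kernel_logDeriv ω hx⟩, fun a ha x hx => tauFun_eq_mul_exp_integral ω ha hx,
    tauFun_eq_theta1 ω, differentiable_tauFun ω, exists_isLiouvillianExtension ω,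
    fun x hx => ?_⟩
  · have hL := notMem_lattice_of_real ω h0 (hxy.trans hy) hx
    exact ⟨isUnit_one_sub_opT ω hL,
      (continuous_kernel_mul_scattering ω hL y).intervalIntegrable _ _, gelfand_levitan ω hL y⟩
  · linear_combination two_mul_weierstrassP_add_d2LogTau ω hx hpi
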